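/- Let $G_{\mathcal P}$ be a directed graph (self-loops allowed) on $\{1,\dots,q\}$ with adjacency matrix $S_{\mathcal P}$, $(s_{\mathcal P})_{ij}=1$ if $(j,i)$ is an edge and $0$ otherwise, let $n_1,\dots,n_q\ge 1$, $n=\sum_i n_i$, and $\epsilon>0$. A vertex $i$ is a sink if it has no edge to a vertex $j\ne i$, and isolated if it has no edge to or from a vertex $j\neq i$. Partition $n\times n$ matrices into blocks $M_{ij}\in\mathbb R^{n_i\times n_j}$. Let $\mathcal A$ be the set of $A\in\mathbb R^{n\times n}$ with $A_{ij}=0$ whenever $(s_{\mathcal P})_{ij}=0$, and let $\mathcal B$ be either the set of block diagonal $B\in\mathbb R^{n\times n}$ (that is, $B_{ij}=0$ for $i\ne j$) with smallest singular value $\underline\sigma(B)\ge\epsilon$, or the set of diagonal $B\in\mathbb R^{n\times n}$ with diagonal entries at least $\epsilon$. A plant is a triple $P=(A,B,x_0)\in\mathcal P=\mathcal A\times\mathcal B\times\mathbb R^n$; for $K\in\mathbb R^{n\times n}$ put $$J_P(K)=\sum_{k\ge1}x(k)^Tx(k)+\sum_{k\ge0}u(k)^Tu(k)\in[0,\infty],\qquad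 x(k+1)=Ax(k)+Bu(k),\quad u(k)=Kx(k),\quad x(0)=x_0.$$ The control graph is complete, i.e. all gains $K\in\mathbb R^{n\times n}$ are admissible. An optimal strategy $K^*$ assigns to each $P$ a gain with $J_P(K^*(P))\le J_P(K)$ for all $K\in\mathbb R^{n\times n}$. The competitive ratio of a map $\Gamma:\mathcal A\times\mathcal B\to\mathbb R^{n\times n}$ is $$r_{\mathcal P}(\Gamma)=\sup_{P=(A,B,x_0)\in\mathcal P}\frac{J_P(\Gamma(A,B))}{J_P(K^*(P))},\qquad \tfrac00:=1.$$ Define $\Gamma^\Theta(A,B)=-\mathrm{diag}(D_1,\dots,D_q)A$, where $D_i=B_{ii}^{-1}$ if $i$ is not a sink of $G_{\mathcal P}$, and $D_i=(I+B_{ii}^TX_{ii}B_{ii})^{-1}B_{ii}^TX_{ii}$ if $i$ is a sink, $X_{ii}$ being the positive definite solution of $$A_{ii}^TX_{ii}B_{ii}(I+B_{ii}^TX_{ii}B_{ii})^{-1}B_{ii}^TX_{ii}A_{ii}-A_{ii}^TX_{ii}A_{ii}+X_{ii}-I=0.$$ Let $(S_{\mathcal P})_{11}$ and $(S_{\mathcal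 P})_{22}$ be the submatrices of $S_{\mathcal P}$ with rows and columns indexed by the non-sinks and by the sinks, respectively. **Theorem.** Assume that $G_{\mathcal P}$ has no isolated vertex and at least one sink. Then $X_{ii}$ exists and is unique for every $(A,B)\in\mathcal A\times\mathcal B$ and every sink $i$; the method $\Gamma^\Theta$ is communication-less (for each $i$, the $i$-th block row of $\Gamma^\Theta(A,B)$ depends only on the $i$-th block row of $A$ and on $B_{ii}$); an optimal strategy $K^*$ exists; and $$r_{\mathcal P}(\Gamma^\Theta)=\begin{cases}1,&\text{if }(S_{\mathcal P})_{11}=0\text{ and }(S_{\mathcal P})_{22}=0,\\[2pt] 1+1/\epsilon^2,&\text{otherwise.}\end{cases}$$ -/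

import Mathlib

open scoped ENNReal Matrix

noncomputable section

namespace LimitedModel

variable {q : ℕ}

/-! ### Graphs on the vertex set `Fin q` (directed, self-loops allowed) -/

/-- A sink has no edge to another vertex (a self-loop is allowed). -/
def IsSink (G : Digraph (Fin q)) (i : Fin q) : Prop :=
  ∀ j, j ≠ i → ¬ G.Adj i j

/-- An isolated vertex has no edge to and no edge from another vertex. -/
def IsIsolated (G : Digraph (Fin q)) (i : Fin q) : Prop :=
  ∀ j, j ≠ i → ¬ G.Adj i j ∧ ¬ G.Adj j i

open Classical in
/-- Adjacency matrix, with the convention `s i j = 1` iff `(j, i)` is an edge. -/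
def adjacency (G : Digraph (Fin q)) : Matrix (Fin q) (Fin q) ℕ :=
  Matrix.of fun i j => if G.Adj j i then 1 else 0

/-- The block `S₁₁` of the adjacency matrix: rows and columns of the vertices that are not sinks. -/
def adjacency₁₁ (G : Digraph (Fin q)) : Matrix {i // ¬ IsSink G i} {i // ¬ IsSink G i} ℕ :=
  (adjacency G).submatrix Subtype.val Subtype.val

/-- The block `S₂₂` of the adjacency matrix: rows and columns of the sinks. -/
def adjacency₂₂ (G : Digraph (Fin q)) : Matrix {i // IsSink G i} {i // IsSink G i} ℕ :=
  (adjacency G).submatrix Subtype.val Subtype.val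

/-- The totally disconnected graph with self-loops. -/
def selfLoops (q : ℕ) : Digraph (Fin q) where
  Adj i j := i = j

/-! ### Plants

Subsystem `i` has dimension `n i`; the state space has coordinates `⟨i, a⟩` with `a : Fin (n i)`. -/

/-- Coordinates of the full state. -/
abbrev StateIdx (n : Fin q → ℕ) : Type := (i : Fin q) × Fin (n i)

/-- Real square matrices of size `∑ i, n i`, with rows and columns grouped by subsystem. -/
abbrev Mat (n : Fin q → ℕ) : Type := Matrix (StateIdx n) (StateIdx n) ℝ

/-- The `(i, j)` block of a matrix. -/
def blk {n : Fin q → ℕ} (M : Mat n) (i j : Fin q) : Matrix (Fin (n i)) (Fin (n j)) ℝ :=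
  Matrix.of fun a b => M ⟨i, a⟩ ⟨j, b⟩

/-- Matrices whose `(i, j)` block vanishes whenever `s i j = 0`. These are the sets `𝒜(S)` of
admissible system matrices and `𝒦(S)` of admissible controller gains. -/
def structuredMatrices (n : Fin q → ℕ) (G : Digraph (Fin q)) : Set (Mat n) :=
  {M | ∀ i j, adjacency G i j = 0 → blk M i j = 0}

/-- `ℬ(ε)`: block diagonal matrices all of whose singular values are at least `ε`. -/
def inputMatrices (n : Fin q → ℕ) (ε : ℝ) : Set (Mat n) :=
  {B | (∀ k < Fintype.card (StateIdx n), ε ≤ (Matrix.toEuclideanLin B).singularValues k) ∧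
    ∀ i j, i ≠ j → blk B i j = 0}

/-- The normalized version of `ℬ(ε)`: diagonal matrices with diagonal entries at least `ε`. -/
def diagonalInputMatrices (n : Fin q → ℕ) (ε : ℝ) : Set (Mat n) :=
  {B | B.IsDiag ∧ ∀ k, ε ≤ B k k}

/-! ### Closed-loop cost -/

/-- The trajectory of `x(k+1) = A x(k) + B u(k)`, `u(k) = K x(k)`, `x(0) = x₀`. -/
def trajectory {n : Fin q → ℕ} (A B K : Mat n) (x₀ : StateIdx n → ℝ) : ℕ → StateIdx n → ℝ
  | 0 => x₀
  | k + 1 => A *ᵥ trajectory A B K x₀ k + B *ᵥ (K *ᵥ trajectory A B K x₀ k)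

/-- `J_P(K) = ∑_{k ≥ 1} x(k)ᵀ x(k) + ∑_{k ≥ 0} u(k)ᵀ u(k)` for `P = (A, B, x₀)`, a number in
`[0, ∞]`. -/
def cost {n : Fin q → ℕ} (A B : Mat n) (x₀ : StateIdx n → ℝ) (K : Mat n) : ℝ≥0∞ :=
  (∑' k : ℕ, ENNReal.ofReal
      (trajectory A B K x₀ (k + 1) ⬝ᵥ trajectory A B K x₀ (k + 1))) +
  ∑' k : ℕ, ENNReal.ofReal
      ((K *ᵥ trajectory A B K x₀ k) ⬝ᵥ (K *ᵥ trajectory A B K x₀ k))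

/-! ### Control design methods and the competitive ratio

The set of plants is `{(A, B, x₀) | A ∈ 𝒜(S_P), B ∈ 𝓑}`, where `𝓑` is a set of input matrices. -/

/-- `Kstar` assigns to every plant a controller in `𝒦(S_K)` of least cost. -/
def IsOptimalStrategy (n : Fin q → ℕ) (GP GK : Digraph (Fin q)) (𝓑 : Set (Mat n))
    (Kstar : Mat n → Mat n → (StateIdx n → ℝ) → Mat n) : Prop :=
  ∀ A ∈ structuredMatrices n GP, ∀ B ∈ 𝓑, ∀ x₀ : StateIdx n → ℝ,
    Kstar A B x₀ ∈ structuredMatrices n GK ∧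
    ∀ K ∈ structuredMatrices n GK, cost A B x₀ (Kstar A B x₀) ≤ cost A B x₀ K

open Classical in
/-- Quotient of costs, with the convention `0 / 0 = 1`. -/
def costRatio (a b : ℝ≥0∞) : ℝ≥0∞ :=
  if a = 0 ∧ b = 0 then 1 else a / b

/-- The competitive ratio of `Γ`: the supremum over all plants `P = (A, B, x₀)` of
`J_P(Γ(A, B)) / J_P(K*(P))`. -/
def competitiveRatio (n : Fin q → ℕ) (GP : Digraph (Fin q)) (𝓑 : Set (Mat n))
    (Kstar : Mat n → Mat n → (StateIdx n → ℝ) → Mat n) (Γ : Mat n → Mat n → Mat n) : ℝ≥0∞ :=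
  ⨆ (A : Mat n) (_ : A ∈ structuredMatrices n GP) (B : Mat n) (_ : B ∈ 𝓑)
    (x₀ : StateIdx n → ℝ),
    costRatio (cost A B x₀ (Γ A B)) (cost A B x₀ (Kstar A B x₀))

/-- The control design methods with structure `GC`: maps from `𝒜(S_P) × 𝓑` to `𝒦(S_K)` such that,
for every `i`, the `i`-th block row of `Γ(A, B)` is a function only of the block rows
`[A_{j1} ⋯ A_{jq}]` and the blocks `B_{jj}` with `(j, i)` an edge of `GC`. -/
def designMethods (n : Fin q → ℕ) (GP GK GC : Digraph (Fin q)) (𝓑 : Set (Mat n)) :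
    Set (Mat n → Mat n → Mat n) :=
  {Γ | (∀ A ∈ structuredMatrices n GP, ∀ B ∈ 𝓑, Γ A B ∈ structuredMatrices n GK) ∧
    ∀ i : Fin q,
      ∀ A ∈ structuredMatrices n GP, ∀ B ∈ 𝓑, ∀ A' ∈ structuredMatrices n GP, ∀ B' ∈ 𝓑,
        (∀ j, adjacency GC i j ≠ 0 → (∀ l, blk A j l = blk A' j l) ∧ blk B j j = blk B' j j) →
        ∀ l, blk (Γ A B) i l = blk (Γ A' B') i l}

/-! ### The method `Γ^Θ` -/

/-- `X` solves the discrete algebraic Riccati equation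
`AᵀXB(I + BᵀXB)⁻¹BᵀXA - AᵀXA + X - I = 0`. -/
def IsRiccatiSolution {m : ℕ} (A B X : Matrix (Fin m) (Fin m) ℝ) : Prop :=
  Aᵀ * X * B * (1 + Bᵀ * X * B)⁻¹ * Bᵀ * X * A - Aᵀ * X * A + X - 1 = 0

/-- The positive definite solution of the Riccati equation (that it exists and is unique for the
plants considered is part of the theorem). -/
def riccatiSolution {m : ℕ} (A B : Matrix (Fin m) (Fin m) ℝ) : Matrix (Fin m) (Fin m) ℝ :=
  Classical.epsilon fun X => X.PosDef ∧ IsRiccatiSolution A B X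

/-- `W = (I + BᵀXB)⁻¹BᵀX`, where `X` is the positive definite solution of the Riccati equation. -/
def lqrGain {m : ℕ} (A B : Matrix (Fin m) (Fin m) ℝ) : Matrix (Fin m) (Fin m) ℝ :=
  (1 + Bᵀ * riccatiSolution A B * B)⁻¹ * Bᵀ * riccatiSolution A B

open Classical in
/-- `Γ^Θ(A, B) = -diag(D₁, …, D_q) A`, where `D_i = B_{ii}⁻¹` (deadbeat) if `i` is not a sink of the
plant graph, and `D_i = W_i(A, B)`, computed from `A_{ii}` and `B_{ii}`, if `i` is a sink. -/
def gammaTheta {n : Fin q → ℕ} (GP : Digraph (Fin q)) (A B : Mat n) : Mat n :=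
  -(Matrix.blockDiagonal' fun i =>
      if IsSink GP i then lqrGain (blk A i i) (blk B i i) else (blk B i i)⁻¹) * A

end LimitedModel

end

/-! Since the cost omits `x(0)`, it depends on `x₀` only through the drift `A x₀`. Under `Γ^Θ` every
non-sink is at zero after one step, and a sink influences nobody else, so from then on each sink is
an independent LQR problem with data `A_ii`, `B_ii`. The cost is therefore at most a sum of block
costs of the initial drift (`cost_gammaTheta_le`), each no larger than the deadbeat energy `|B_ii⁻¹
v|²`.

Any gain pays at least its first stage `|v + Bu|² + |u|²`. As `|Bw| ≥ ε|w|`, completing a square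
gives `|B⁻¹ v|² ≤ (1 + 1/ε²)(|v + Bu|² + |u|²)` (`inv_dotProduct_le`), which is the upper bound. If
both adjacency blocks vanish, non-sinks have no drift and sinks have `A_ii = 0`, so `X_ii = I` and
the first stage is already matched: the ratio is 1.

The constant is approached with `B = εI` and `A` nonzero in one row. An edge into a non-sink makes
deadbeat overspend on a small drift (`le_competitiveRatio_of_adj_not_isSink`). At a sink with a
self-loop, an upstream neighbour can cheaply cancel the next drift through a very strong link,
whereas `Γ^Θ` leaves that neighbour idle (`le_competitiveRatio_of_isSink_adj_self`); such a
neighbour exists because the sink is not isolated.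

Existence of `X` and of optimal gains is classical LQR theory for invertible `B`. -/

namespace LimitedModel

/-! ### Discrete Riccati equation: existence and uniqueness for invertible input matrices. -/

section Riccati

open Filter Topology

variable {ι : Type*} [Fintype ι]

/-- The quadratic form `xᵀXx`. -/
def quadForm (X : Matrix ι ι ℝ) (x : ι → ℝ) : ℝ := x ⬝ᵥ X *ᵥ x

theorem dotProduct_mulVec_comm_transpose {κ : Type*} [Fintype κ] (M : Matrix ι κ ℝ) (a : ι → ℝ)
    (b : κ → ℝ) : a ⬝ᵥ M *ᵥ b = b ⬝ᵥ Mᵀ *ᵥ a := by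
  rw [Matrix.dotProduct_mulVec, ← Matrix.mulVec_transpose, dotProduct_comm]

theorem continuous_quadForm (X : Matrix ι ι ℝ) : Continuous (quadForm X) := by
  unfold quadForm
  fun_prop

theorem dotProduct_self_nonneg' (x : ι → ℝ) : 0 ≤ x ⬝ᵥ x :=
  Finset.sum_nonneg fun i _ => mul_self_nonneg (x i)

theorem quadForm_nonneg {X : Matrix ι ι ℝ} (hX : X.PosSemidef) (x : ι → ℝ) : 0 ≤ quadForm X x := by
  simpa [quadForm] using hX.dotProduct_mulVec_nonneg x

/-- Polarization; it turns convergence or equality of quadratic forms into that of matrix entries.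
-/
theorem apply_eq_quadForm [DecidableEq ι] {X : Matrix ι ι ℝ} (hX : Xᵀ = X) (a b : ι) :
    X a b = (quadForm X (Pi.single a 1 + Pi.single b 1) - quadForm X (Pi.single a 1) -
      quadForm X (Pi.single b 1)) / 2 := by
  have : X b a = X a b := by conv_lhs => rw [← hX, Matrix.transpose_apply]
  simp [quadForm, Matrix.mulVec_add, add_dotProduct, dotProduct_add, this]
  ring

theorem eq_of_quadForm_eq {X Y : Matrix ι ι ℝ} (hX : Xᵀ = X) (hY : Yᵀ = Y)
    (h : ∀ x, quadForm X x = quadForm Y x) : X = Y := by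
  classical
  ext a b
  rw [apply_eq_quadForm hX, apply_eq_quadForm hY]
  simp only [h]

theorem posSemidef_transpose_eq {ι : Type*} {X : Matrix ι ι ℝ} (hX : X.PosSemidef) : Xᵀ = X := by
  have := hX.isHermitian.eq
  rwa [Matrix.conjTranspose_eq_transpose_of_trivial] at this

theorem posSemidef_of_quadForm {X : Matrix ι ι ℝ} (hX : Xᵀ = X) (h : ∀ x, 0 ≤ quadForm X x) :
    X.PosSemidef := by
  refine Matrix.posSemidef_iff_dotProduct_mulVec.2 ⟨?_, fun x => by simpa [quadForm] using h x⟩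
  rwa [Matrix.IsHermitian, Matrix.conjTranspose_eq_transpose_of_trivial]

theorem tendsto_zero_of_dotProduct_self {x : ℕ → ι → ℝ}
    (h : Tendsto (fun k => x k ⬝ᵥ x k) atTop (𝓝 0)) : Tendsto x atTop (𝓝 0) := by
  refine tendsto_pi_nhds.2 fun i => ?_
  have h1 : Tendsto (fun k => x k i ^ 2) atTop (𝓝 0) := by
    refine squeeze_zero (fun k => sq_nonneg _) (fun k => ?_) h
    rw [sq]
    exact Finset.single_le_sum (f := fun j => x k j * x k j) (fun j _ => mul_self_nonneg _)
      (Finset.mem_univ i)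
  have h2 := h1.sqrt
  simp only [Real.sqrt_sq_eq_abs, Real.sqrt_zero] at h2
  exact (tendsto_zero_iff_abs_tendsto_zero _).2 h2

variable [DecidableEq ι]

/-- The least squares gain `(I + BᵀXB)⁻¹BᵀX`. -/
noncomputable def feedbackGain (B X : Matrix ι ι ℝ) : Matrix ι ι ℝ := (1 + Bᵀ * X * B)⁻¹ * Bᵀ * X

/-- The matrix `X - XB(I + BᵀXB)⁻¹BᵀX` of the minimal one-step cost. -/
noncomputable def stepMatrix (B X : Matrix ι ι ℝ) : Matrix ι ι ℝ :=
  X - X * B * feedbackGain B X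

theorem posDef_one_add {X : Matrix ι ι ℝ} (hX : X.PosSemidef) (B : Matrix ι ι ℝ) :
    (1 + Bᵀ * X * B).PosDef := by
  have := hX.conjTranspose_mul_mul_same B
  rw [Matrix.conjTranspose_eq_transpose_of_trivial] at this
  exact Matrix.PosDef.one.add_posSemidef this

theorem mul_feedbackGain {X : Matrix ι ι ℝ} (hX : X.PosSemidef) (B : Matrix ι ι ℝ) :
    (1 + Bᵀ * X * B) * feedbackGain B X = Bᵀ * X := by
  have hu := (Matrix.isUnit_iff_isUnit_det _).1 (posDef_one_add hX B).isUnit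
  rw [feedbackGain, Matrix.mul_assoc _ Bᵀ X, Matrix.mul_nonsing_inv_cancel_left _ _ hu]

/-- Completing the square in `u`: the remainder is a nonnegative form vanishing at `u =
-feedbackGain B X *ᵥ v`, so `stepMatrix B X` is the exact minimum over `u`. -/
theorem step_complete_square {X : Matrix ι ι ℝ} (hX : X.PosSemidef) (B : Matrix ι ι ℝ)
    (v u : ι → ℝ) :
    u ⬝ᵥ u + quadForm X (v + B *ᵥ u) = quadForm (stepMatrix B X) v +
      quadForm (1 + Bᵀ * X * B) (u + feedbackGain B X *ᵥ v) := by
  have hXt := posSemidef_transpose_eq hX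
  set w := feedbackGain B X *ᵥ v with hw
  have hM : (1 + Bᵀ * X * B) *ᵥ w = Bᵀ *ᵥ (X *ᵥ v) := by
    rw [hw, Matrix.mulVec_mulVec, mul_feedbackGain hX, Matrix.mulVec_mulVec]
  have hMt : (1 + Bᵀ * X * B)ᵀ = 1 + Bᵀ * X * B := by
    simp [Matrix.transpose_mul, hXt, Matrix.mul_assoc]
  have hY : stepMatrix B X *ᵥ v = X *ᵥ v - X *ᵥ (B *ᵥ w) := by
    rw [stepMatrix, Matrix.sub_mulVec, hw, Matrix.mulVec_mulVec, Matrix.mulVec_mulVec,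
      Matrix.mul_assoc]
  have hMu : (1 + Bᵀ * X * B) *ᵥ u = u + Bᵀ *ᵥ (X *ᵥ (B *ᵥ u)) := by
    rw [Matrix.add_mulVec, Matrix.one_mulVec, Matrix.mulVec_mulVec, Matrix.mulVec_mulVec]
  simp only [quadForm]
  rw [hY, Matrix.mulVec_add (1 + Bᵀ * X * B), hM, hMu]
  have h1 : w ⬝ᵥ (u + Bᵀ *ᵥ (X *ᵥ (B *ᵥ u))) = u ⬝ᵥ Bᵀ *ᵥ (X *ᵥ v) := by
    rw [← hMu, dotProduct_mulVec_comm_transpose, hMt, hM]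
  have h2 : v ⬝ᵥ X *ᵥ (B *ᵥ w) = w ⬝ᵥ Bᵀ *ᵥ (X *ᵥ v) := by
    rw [dotProduct_mulVec_comm_transpose X, hXt, dotProduct_comm,
      dotProduct_mulVec_comm_transpose B]
  have h3 : v ⬝ᵥ X *ᵥ (B *ᵥ u) = u ⬝ᵥ Bᵀ *ᵥ (X *ᵥ v) := by
    rw [dotProduct_mulVec_comm_transpose X, hXt, dotProduct_comm,
      dotProduct_mulVec_comm_transpose B]
  have h4 : (B *ᵥ u) ⬝ᵥ X *ᵥ v = u ⬝ᵥ Bᵀ *ᵥ (X *ᵥ v) := by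
    rw [dotProduct_comm, dotProduct_mulVec_comm_transpose B]
  have h5 : (B *ᵥ u) ⬝ᵥ X *ᵥ (B *ᵥ u) = u ⬝ᵥ Bᵀ *ᵥ (X *ᵥ (B *ᵥ u)) := by
    rw [dotProduct_comm, dotProduct_mulVec_comm_transpose B]
  simp only [Matrix.mulVec_add, add_dotProduct, dotProduct_add, dotProduct_sub] at h1 ⊢
  linarith

theorem stepMatrix_le {X : Matrix ι ι ℝ} (hX : X.PosSemidef) (B : Matrix ι ι ℝ) (v u : ι → ℝ) :
    quadForm (stepMatrix B X) v ≤ u ⬝ᵥ u + quadForm X (v + B *ᵥ u) := by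
  rw [step_complete_square hX]
  have := quadForm_nonneg (posDef_one_add hX B).posSemidef (u + feedbackGain B X *ᵥ v)
  linarith

theorem stepMatrix_eq {X : Matrix ι ι ℝ} (hX : X.PosSemidef) (B : Matrix ι ι ℝ) (v : ι → ℝ) :
    (-(feedbackGain B X *ᵥ v)) ⬝ᵥ (-(feedbackGain B X *ᵥ v)) +
      quadForm X (v + B *ᵥ (-(feedbackGain B X *ᵥ v))) = quadForm (stepMatrix B X) v := by
  rw [step_complete_square hX]
  simp [quadForm]

theorem stepMatrix_transpose {X : Matrix ι ι ℝ} (hX : X.PosSemidef) (B : Matrix ι ι ℝ) :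
    (stepMatrix B X)ᵀ = stepMatrix B X := by
  have hXt := posSemidef_transpose_eq hX
  have hMt : (1 + Bᵀ * X * B)ᵀ = 1 + Bᵀ * X * B := by
    simp [Matrix.transpose_mul, hXt, Matrix.mul_assoc]
  rw [stepMatrix, feedbackGain]
  generalize 1 + Bᵀ * X * B = M at hMt
  simp only [Matrix.transpose_sub, Matrix.transpose_mul, Matrix.transpose_nonsing_inv, hMt, hXt,
    Matrix.transpose_transpose, Matrix.mul_assoc]

theorem stepMatrix_posSemidef {X : Matrix ι ι ℝ} (hX : X.PosSemidef) (B : Matrix ι ι ℝ) :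
    (stepMatrix B X).PosSemidef := by
  refine posSemidef_of_quadForm (stepMatrix_transpose hX B) fun v => ?_
  rw [← stepMatrix_eq hX]
  exact add_nonneg (dotProduct_self_nonneg' _) (quadForm_nonneg hX _)

theorem stepMatrix_le_inv {X B : Matrix ι ι ℝ} (hX : X.PosSemidef) (hB : IsUnit B) (v : ι → ℝ) :
    quadForm (stepMatrix B X) v ≤ (B⁻¹ *ᵥ v) ⬝ᵥ (B⁻¹ *ᵥ v) := by
  have h := stepMatrix_le hX B v (-(B⁻¹ *ᵥ v))
  rw [Matrix.mulVec_neg, Matrix.mulVec_mulVec,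
    Matrix.mul_nonsing_inv _ ((Matrix.isUnit_iff_isUnit_det _).1 hB), Matrix.one_mulVec] at h
  simpa [quadForm] using h

/-- The Riccati operator `X ↦ I + Aᵀ(X - XB(I + BᵀXB)⁻¹BᵀX)A`. -/
noncomputable def riccatiMap (A B X : Matrix ι ι ℝ) : Matrix ι ι ℝ := 1 + Aᵀ * stepMatrix B X * A

theorem quadForm_riccatiMap (A B X : Matrix ι ι ℝ) (x : ι → ℝ) :
    quadForm (riccatiMap A B X) x = x ⬝ᵥ x + quadForm (stepMatrix B X) (A *ᵥ x) := by
  simp only [quadForm, riccatiMap, Matrix.add_mulVec, Matrix.one_mulVec, dotProduct_add,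
    add_right_inj]
  rw [← Matrix.mulVec_mulVec, ← Matrix.mulVec_mulVec, dotProduct_mulVec_comm_transpose,
    Matrix.transpose_transpose, dotProduct_comm]

theorem riccatiMap_posDef {X : Matrix ι ι ℝ} (hX : X.PosSemidef) (A B : Matrix ι ι ℝ) :
    (riccatiMap A B X).PosDef := by
  have := (stepMatrix_posSemidef hX B).conjTranspose_mul_mul_same A
  rw [Matrix.conjTranspose_eq_transpose_of_trivial] at this
  exact Matrix.PosDef.one.add_posSemidef this

/-- The minimizer for `X'` is a competitor in the problem for `X`. -/
theorem riccatiMap_mono {X X' : Matrix ι ι ℝ} (hX : X.PosSemidef) (hX' : X'.PosSemidef)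
    (h : ∀ x, quadForm X x ≤ quadForm X' x) (A B : Matrix ι ι ℝ) (x : ι → ℝ) :
    quadForm (riccatiMap A B X) x ≤ quadForm (riccatiMap A B X') x := by
  rw [quadForm_riccatiMap, quadForm_riccatiMap, ← stepMatrix_eq hX']
  have := stepMatrix_le hX B (A *ᵥ x) (-(feedbackGain B X' *ᵥ (A *ᵥ x)))
  have := h (A *ᵥ x + B *ᵥ (-(feedbackGain B X' *ᵥ (A *ᵥ x))))
  linarith

theorem riccatiMap_continuousAt {X : Matrix ι ι ℝ} (hX : X.PosSemidef) (A B : Matrix ι ι ℝ) :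
    ContinuousAt (riccatiMap A B) X := by
  have hu := (Matrix.isUnit_iff_isUnit_det _).1 (posDef_one_add hX B).isUnit
  have hinv : ContinuousAt (fun Z : Matrix ι ι ℝ => (1 + Bᵀ * Z * B)⁻¹) X := by
    have hc : Continuous fun Z : Matrix ι ι ℝ => 1 + Bᵀ * Z * B := by fun_prop
    simp only [Matrix.inv_def, Ring.inverse_eq_inv']
    exact (hc.matrix_det.continuousAt.inv₀ hu.ne_zero).smul hc.matrix_adjugate.continuousAt
  unfold riccatiMap stepMatrix feedbackGain
  fun_prop

/-- Value iteration from 0 increases and stays below the cost of deadbeat control, hence converges;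
continuity makes the limit a fixed point. -/
theorem exists_riccati_fixedPoint (A : Matrix ι ι ℝ) {B : Matrix ι ι ℝ} (hB : IsUnit B) :
    ∃ X : Matrix ι ι ℝ, X.PosDef ∧ riccatiMap A B X = X := by
  let S : ℕ → Matrix ι ι ℝ := fun k => (riccatiMap A B)^[k] 0
  have hS : ∀ k, S (k + 1) = riccatiMap A B (S k) := fun k =>
    Function.iterate_succ_apply' _ _ _
  have hpos : ∀ k, (S k).PosSemidef := by
    intro k
    induction k with
    | zero => exact Matrix.PosSemidef.zero
    | succ k ih => rw [hS]; exact (riccatiMap_posDef ih A B).posSemidef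
  have hmono : ∀ x, Monotone fun k => quadForm (S k) x := by
    intro x
    refine monotone_nat_of_le_succ fun k => ?_
    revert x
    induction k with
    | zero => intro x; simpa [S, quadForm] using quadForm_nonneg (hpos 1) x
    | succ k ih =>
      intro x
      rw [hS, hS (k + 1)]
      exact riccatiMap_mono (hpos _) (hpos _) ih A B x
  have hbdd : ∀ x, BddAbove (Set.range fun k => quadForm (S k) x) := by
    intro x
    refine ⟨x ⬝ᵥ x + (B⁻¹ *ᵥ (A *ᵥ x)) ⬝ᵥ (B⁻¹ *ᵥ (A *ᵥ x)), ?_⟩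
    rintro _ ⟨k, rfl⟩
    -- Moving to index `k + 1` exhibits a value of the Riccati operator, which the deadbeat input
    -- bounds uniformly in `k`.
    refine (hmono x k.le_succ).trans ?_
    simp only [Nat.succ_eq_add_one]
    rw [hS, quadForm_riccatiMap]
    have := stepMatrix_le_inv (hpos k) hB (A *ᵥ x)
    linarith
  have hlim : ∀ x, Tendsto (fun k => quadForm (S k) x) atTop (𝓝 (⨆ k, quadForm (S k) x)) :=
    fun x => tendsto_atTop_ciSup (hmono x) (hbdd x)
  have hentry : ∀ a b, ∃ l, Tendsto (fun k => S k a b) atTop (𝓝 l) := by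
    intro a b
    simp only [apply_eq_quadForm (posSemidef_transpose_eq (hpos _)) a b]
    exact ⟨_, (((hlim _).sub (hlim _)).sub (hlim _)).div_const 2⟩
  choose L hL using hentry
  have hX : Tendsto S atTop (𝓝 (Matrix.of L)) :=
    tendsto_pi_nhds.2 fun a => tendsto_pi_nhds.2 fun b => hL a b
  have hXpos : (Matrix.of L).PosSemidef := by
    refine posSemidef_of_quadForm ?_ fun x => ?_
    · refine tendsto_nhds_unique (f := fun k => (S k)ᵀ) (l := atTop) ?_ ?_
      · exact ((continuous_id.matrix_transpose).tendsto _).comp hX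
      · simpa only [posSemidef_transpose_eq (hpos _)] using hX
    · have hc : Continuous fun Z : Matrix ι ι ℝ => quadForm Z x := by
        unfold quadForm; fun_prop
      exact ge_of_tendsto' ((hc.tendsto _).comp hX) fun k => quadForm_nonneg (hpos k) x
  have hfix : riccatiMap A B (Matrix.of L) = Matrix.of L := by
    refine tendsto_nhds_unique ((riccatiMap_continuousAt hXpos A B).tendsto.comp hX) ?_
    have := hX.comp (tendsto_add_atTop_nat 1)
    refine this.congr fun k => ?_
    simp only [Function.comp_apply, hS]
  refine ⟨_, ?_, hfix⟩
  -- The limit is a priori only semidefinite; being a value of `riccatiMap`, it contains the summand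
  -- `I`.
  rw [← hfix]
  exact riccatiMap_posDef hXpos A B

/-- Along the closed loop optimal for `X` the states are square summable, hence tend to 0. There the
feedback is merely suboptimal for `X'`, so the form of `X' - X` does not decrease along the
trajectory, while its limit is 0. -/
theorem riccati_fixedPoint_le {A B X X' : Matrix ι ι ℝ} (hX : X.PosSemidef) (hX' : X'.PosSemidef)
    (h : riccatiMap A B X = X) (h' : riccatiMap A B X' = X') (x₀ : ι → ℝ) :
    quadForm X' x₀ ≤ quadForm X x₀ := by
  let F : (ι → ℝ) → ι → ℝ := fun x => A *ᵥ x + B *ᵥ (-(feedbackGain B X *ᵥ (A *ᵥ x)))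
  let u : (ι → ℝ) → ι → ℝ := fun x => -(feedbackGain B X *ᵥ (A *ᵥ x))
  have h1 : ∀ x, quadForm X x = x ⬝ᵥ x + (u x ⬝ᵥ u x + quadForm X (F x)) := fun x => by
    conv_lhs => rw [← h, quadForm_riccatiMap, ← stepMatrix_eq hX]
  have h2 : ∀ x, quadForm X' x ≤ x ⬝ᵥ x + (u x ⬝ᵥ u x + quadForm X' (F x)) := fun x => by
    conv_lhs => rw [← h', quadForm_riccatiMap]
    exact add_le_add le_rfl (stepMatrix_le hX' B _ _)
  let y : ℕ → ι → ℝ := fun k => F^[k] x₀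
  have hy : ∀ k, y (k + 1) = F (y k) := fun k => Function.iterate_succ_apply' _ _ _
  have hsum : ∀ N, ∑ k ∈ Finset.range N, y k ⬝ᵥ y k ≤ quadForm X x₀ - quadForm X (y N) := by
    intro N
    induction N with
    | zero => simp [y]
    | succ N ih =>
      rw [Finset.sum_range_succ, hy]
      have := h1 (y N)
      have := dotProduct_self_nonneg' (u (y N))
      linarith
  have hs : Summable fun k => y k ⬝ᵥ y k :=
    summable_of_sum_range_le (c := quadForm X x₀) (fun k => dotProduct_self_nonneg' _) fun N => by
      have := hsum N
      have := quadForm_nonneg hX (y N)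
      linarith
  have hy0 : Tendsto y atTop (𝓝 0) := tendsto_zero_of_dotProduct_self hs.tendsto_atTop_zero
  have hdiff : ∀ N, quadForm X' x₀ - quadForm X x₀ ≤ quadForm X' (y N) - quadForm X (y N) := by
    intro N
    induction N with
    | zero => simp [y]
    | succ N ih =>
      rw [hy]
      have := h1 (y N)
      have := h2 (y N)
      linarith
  have hl : Tendsto (fun N => quadForm X' (y N) - quadForm X (y N)) atTop (𝓝 0) := by
    have := (((continuous_quadForm X').sub (continuous_quadForm X)).tendsto 0).comp hy0
    simpa [quadForm, Function.comp_def] using this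
  have := ge_of_tendsto' hl hdiff
  linarith

theorem existsUnique_riccati_fixedPoint (A : Matrix ι ι ℝ) {B : Matrix ι ι ℝ} (hB : IsUnit B) :
    ∃! X : Matrix ι ι ℝ, X.PosDef ∧ riccatiMap A B X = X := by
  obtain ⟨X, hX, hfix⟩ := exists_riccati_fixedPoint A hB
  refine ⟨X, ⟨hX, hfix⟩, fun X' ⟨hX', hfix'⟩ => ?_⟩
  refine eq_of_quadForm_eq (posSemidef_transpose_eq hX'.posSemidef)
    (posSemidef_transpose_eq hX.posSemidef) fun x => le_antisymm ?_ ?_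
  · exact riccati_fixedPoint_le hX.posSemidef hX'.posSemidef hfix hfix' x
  · exact riccati_fixedPoint_le hX'.posSemidef hX.posSemidef hfix' hfix x

theorem isRiccatiSolution_iff {m : ℕ} {A B X : Matrix (Fin m) (Fin m) ℝ} :
    IsRiccatiSolution A B X ↔ riccatiMap A B X = X := by
  have : Aᵀ * X * B * (1 + Bᵀ * X * B)⁻¹ * Bᵀ * X * A - Aᵀ * X * A + X - 1 =
      X - riccatiMap A B X := by
    simp only [riccatiMap, stepMatrix, feedbackGain, Matrix.mul_sub, Matrix.sub_mul,
      Matrix.mul_assoc]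
    abel
  rw [IsRiccatiSolution, this, sub_eq_zero, eq_comm]

end Riccati

end LimitedModel

namespace LimitedModel

/-! ### Infinite-horizon cost, optimal gains, and bounds on the competitive ratio. -/

section Cost

open Filter Topology

variable {q : ℕ} {n : Fin q → ℕ}

theorem cost_eq_tsum (A B K : Mat n) (x₀ : StateIdx n → ℝ) :
    cost A B x₀ K = ∑' k : ℕ, ENNReal.ofReal
      (trajectory A B K x₀ (k + 1) ⬝ᵥ trajectory A B K x₀ (k + 1) +
        (K *ᵥ trajectory A B K x₀ k) ⬝ᵥ (K *ᵥ trajectory A B K x₀ k)) := by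
  rw [cost, ← ENNReal.tsum_add]
  exact tsum_congr fun k =>
    (ENNReal.ofReal_add (dotProduct_self_nonneg' _) (dotProduct_self_nonneg' _)).symm

theorem sum_stage_le_cost (A B K : Mat n) (x₀ : StateIdx n → ℝ) (N : ℕ) :
    ENNReal.ofReal (∑ k ∈ Finset.range N,
      (trajectory A B K x₀ (k + 1) ⬝ᵥ trajectory A B K x₀ (k + 1) +
        (K *ᵥ trajectory A B K x₀ k) ⬝ᵥ (K *ᵥ trajectory A B K x₀ k))) ≤ cost A B x₀ K := by
  rw [cost_eq_tsum, ENNReal.ofReal_sum_of_nonneg fun k _ =>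
    add_nonneg (dotProduct_self_nonneg' _) (dotProduct_self_nonneg' _)]
  exact ENNReal.sum_le_tsum _

/-- One step along the closed loop bounds the cost from below. -/
theorem first_stage_le_cost (A B K : Mat n) (x₀ : StateIdx n → ℝ) :
    ENNReal.ofReal ((A *ᵥ x₀ + B *ᵥ (K *ᵥ x₀)) ⬝ᵥ (A *ᵥ x₀ + B *ᵥ (K *ᵥ x₀)) +
      (K *ᵥ x₀) ⬝ᵥ (K *ᵥ x₀)) ≤ cost A B x₀ K := by
  simpa [trajectory] using sum_stage_le_cost A B K x₀ 1

/-- A nonnegative function that decreases by at least the stage cost along the closed loop bounds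
the cost from above. -/
theorem cost_le_of_potential {A B K : Mat n} (V : (StateIdx n → ℝ) → ℝ) (hV : ∀ x, 0 ≤ V x)
    (hstep : ∀ x, (A *ᵥ x + B *ᵥ (K *ᵥ x)) ⬝ᵥ (A *ᵥ x + B *ᵥ (K *ᵥ x)) + (K *ᵥ x) ⬝ᵥ (K *ᵥ x) +
      V (A *ᵥ x + B *ᵥ (K *ᵥ x)) ≤ V x) (x₀ : StateIdx n → ℝ) :
    cost A B x₀ K ≤ ENNReal.ofReal (V x₀) := by
  rw [cost_eq_tsum]
  refine ENNReal.tsum_le_of_sum_range_le fun N => ?_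
  rw [← ENNReal.ofReal_sum_of_nonneg fun k _ =>
    add_nonneg (dotProduct_self_nonneg' _) (dotProduct_self_nonneg' _)]
  refine ENNReal.ofReal_le_ofReal ?_
  suffices h : ∑ k ∈ Finset.range N,
      (trajectory A B K x₀ (k + 1) ⬝ᵥ trajectory A B K x₀ (k + 1) +
        (K *ᵥ trajectory A B K x₀ k) ⬝ᵥ (K *ᵥ trajectory A B K x₀ k)) ≤
      V x₀ - V (trajectory A B K x₀ N) by
    have := hV (trajectory A B K x₀ N)
    linarith
  induction N with
  | zero => simp [trajectory]
  | succ N ih =>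
    rw [Finset.sum_range_succ]
    have := hstep (trajectory A B K x₀ N)
    simp only [trajectory] at *
    linarith

/-- A continuous function vanishing at the origin that decreases by at most the stage cost along the
closed loop bounds the cost from below. -/
theorem le_cost_of_potential {A B K : Mat n} (V : (StateIdx n → ℝ) → ℝ) (hV : Continuous V)
    (hV0 : V 0 = 0)
    (hstep : ∀ x, V x ≤ (A *ᵥ x + B *ᵥ (K *ᵥ x)) ⬝ᵥ (A *ᵥ x + B *ᵥ (K *ᵥ x)) +
      (K *ᵥ x) ⬝ᵥ (K *ᵥ x) + V (A *ᵥ x + B *ᵥ (K *ᵥ x))) (x₀ : StateIdx n → ℝ) :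
    ENNReal.ofReal (V x₀) ≤ cost A B x₀ K := by
  by_cases htop : cost A B x₀ K = ∞
  · rw [htop]; exact le_top
  set x := trajectory A B K x₀ with hx
  -- Finite cost controls the states only from time 1 on, which suffices for the limit.
  have hx1 : Tendsto (fun k => x (k + 1)) atTop (𝓝 0) := by
    refine tendsto_zero_of_dotProduct_self ?_
    have h1 : ∑' k, ENNReal.ofReal (x (k + 1) ⬝ᵥ x (k + 1)) ≠ ∞ :=
      ne_top_of_le_ne_top htop le_self_add
    refine (ENNReal.summable_toReal h1).tendsto_atTop_zero.congr fun k => ?_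
    exact ENNReal.toReal_ofReal (dotProduct_self_nonneg' _)
  have hxV : Tendsto (fun k => ENNReal.ofReal (V (x k))) atTop (𝓝 0) := by
    have h0 := (hV.tendsto 0).comp ((tendsto_add_atTop_iff_nat 1).1 hx1)
    rw [hV0] at h0
    simpa [Function.comp_def] using ENNReal.tendsto_ofReal h0
  have hle : ∀ N, ENNReal.ofReal (V x₀) ≤ cost A B x₀ K + ENNReal.ofReal (V (x N)) := by
    intro N
    refine le_trans ?_ (add_le_add_left (sum_stage_le_cost A B K x₀ N) _)
    refine le_trans (ENNReal.ofReal_le_ofReal ?_) ENNReal.ofReal_add_le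
    induction N with
    | zero => simp [x, trajectory]
    | succ N ih =>
      rw [Finset.sum_range_succ]
      have := hstep (x N)
      simp only [x, trajectory] at *
      linarith
  have := ge_of_tendsto' (tendsto_const_nhds.add hxV) hle
  simpa using this

/-- Bellman verification. As `x(0)` is not charged, the value function is the form of `stepMatrix B
X` at `A x`, that is `xᵀXx - xᵀx`. The optimal gain does not depend on `x₀`. -/
theorem cost_feedbackGain_le {A B X : Mat n} (hX : X.PosSemidef) (hfix : riccatiMap A B X = X)
    (K : Mat n) (x₀ : StateIdx n → ℝ) :
    cost A B x₀ (-(feedbackGain B X * A)) ≤ cost A B x₀ K := by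
  have hq : ∀ x, quadForm X x = x ⬝ᵥ x + quadForm (stepMatrix B X) (A *ᵥ x) := fun x => by
    conv_lhs => rw [← hfix, quadForm_riccatiMap]
  refine (cost_le_of_potential (fun x => quadForm (stepMatrix B X) (A *ᵥ x))
    (fun x => quadForm_nonneg (stepMatrix_posSemidef hX B) _) (fun x => ?_) x₀).trans
    (le_cost_of_potential (fun x => quadForm (stepMatrix B X) (A *ᵥ x)) ?_ ?_ (fun x => ?_) x₀)
  · have h := stepMatrix_eq hX B (A *ᵥ x)
    rw [hq] at h
    rw [Matrix.neg_mulVec, ← Matrix.mulVec_mulVec]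
    linarith
  · exact (continuous_quadForm _).comp (by fun_prop)
  · simp [quadForm]
  · have h := stepMatrix_le hX B (A *ᵥ x) (K *ᵥ x)
    rw [hq] at h
    linarith

theorem adjacency_eq_zero_iff {G : Digraph (Fin q)} {i j : Fin q} :
    adjacency G i j = 0 ↔ ¬ G.Adj j i := by
  simp [adjacency]

theorem structuredMatrices_top : structuredMatrices n ⊤ = Set.univ := by
  ext M
  simp [structuredMatrices, adjacency_eq_zero_iff]

theorem exists_isOptimalStrategy (GP : Digraph (Fin q)) {𝓑 : Set (Mat n)}
    (h𝓑 : ∀ B ∈ 𝓑, IsUnit B) : ∃ Kstar, IsOptimalStrategy n GP ⊤ 𝓑 Kstar := by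
  have h : ∀ A B : Mat n, ∃ K : Mat n, B ∈ 𝓑 → ∀ x₀ K', cost A B x₀ K ≤ cost A B x₀ K' := by
    intro A B
    by_cases hB : B ∈ 𝓑
    · obtain ⟨X, hX, hfix⟩ := exists_riccati_fixedPoint A (h𝓑 B hB)
      exact ⟨_, fun _ x₀ K => cost_feedbackGain_le hX.posSemidef hfix K x₀⟩
    · exact ⟨0, fun h => absurd h hB⟩
  choose F hF using h
  refine ⟨fun A B _ => F A B, fun A _ B hB x₀ => ⟨?_, fun K _ => hF A B hB x₀ K⟩⟩
  rw [structuredMatrices_top]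
  trivial

/-- The plant with `A = 0`, `x₀ = 0` has both costs zero and contributes `0/0 = 1`. -/
theorem one_le_competitiveRatio {GP : Digraph (Fin q)} {𝓑 : Set (Mat n)} (hne : 𝓑.Nonempty)
    {Kstar : Mat n → Mat n → (StateIdx n → ℝ) → Mat n} (Γ : Mat n → Mat n → Mat n)
    (hK : IsOptimalStrategy n GP ⊤ 𝓑 Kstar) (hΓ : ∀ B ∈ 𝓑, Γ 0 B = 0) :
    1 ≤ competitiveRatio n GP 𝓑 Kstar Γ := by
  obtain ⟨B, hB⟩ := hne
  have h0 : (0 : Mat n) ∈ structuredMatrices n GP := fun i j _ => rfl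
  have hz : cost 0 B 0 (0 : Mat n) = 0 := by
    have := cost_le_of_potential (A := 0) (B := B) (K := 0) (fun _ => 0) (fun _ => le_rfl)
      (by simp) 0
    simpa using this
  have hz' : cost 0 B 0 (Kstar 0 B 0) = 0 := by
    have := (hK 0 h0 B hB 0).2 0 (by rw [structuredMatrices_top]; trivial)
    simpa [hz] using this
  refine le_trans ?_ (le_iSup₂_of_le 0 h0 (le_iSup₂_of_le B hB (le_iSup_of_le 0 le_rfl)))
  rw [hΓ B hB, hz, hz', costRatio, if_pos ⟨rfl, rfl⟩]

theorem competitiveRatio_le {GP : Digraph (Fin q)} {𝓑 : Set (Mat n)}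
    {Kstar : Mat n → Mat n → (StateIdx n → ℝ) → Mat n} {Γ : Mat n → Mat n → Mat n} {c : ℝ≥0∞}
    (hc : 1 ≤ c) (h : ∀ A ∈ structuredMatrices n GP, ∀ B ∈ 𝓑, ∀ x₀ K,
      cost A B x₀ (Γ A B) ≤ c * cost A B x₀ K) :
    competitiveRatio n GP 𝓑 Kstar Γ ≤ c := by
  refine iSup₂_le fun A hA => iSup₂_le fun B hB => iSup_le fun x₀ => ?_
  rw [costRatio]
  split_ifs
  · exact hc
  · exact ENNReal.div_le_of_le_mul (h A hA B hB x₀ _)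

theorem le_competitiveRatio {GP : Digraph (Fin q)} {𝓑 : Set (Mat n)}
    {Kstar : Mat n → Mat n → (StateIdx n → ℝ) → Mat n} {Γ : Mat n → Mat n → Mat n}
    (hK : IsOptimalStrategy n GP ⊤ 𝓑 Kstar) {A B : Mat n} (hA : A ∈ structuredMatrices n GP)
    (hB : B ∈ 𝓑) (x₀ : StateIdx n → ℝ) (K : Mat n) {a b : ℝ} (ha : 0 < a) (hb : 0 < b)
    (hΓ : ENNReal.ofReal a ≤ cost A B x₀ (Γ A B)) (hKb : cost A B x₀ K ≤ ENNReal.ofReal b) :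
    ENNReal.ofReal (a / b) ≤ competitiveRatio n GP 𝓑 Kstar Γ := by
  refine le_trans ?_ (le_iSup₂_of_le A hA (le_iSup₂_of_le B hB (le_iSup_of_le x₀ le_rfl)))
  have h1 : cost A B x₀ (Γ A B) ≠ 0 := (lt_of_lt_of_le (ENNReal.ofReal_pos.2 ha) hΓ).ne'
  rw [costRatio, if_neg fun h => h1 h.1, ENNReal.ofReal_div_of_pos hb]
  exact ENNReal.div_le_div hΓ
    (((hK A hA B hB x₀).2 K (by rw [structuredMatrices_top]; trivial)).trans hKb)

end Cost

end LimitedModel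

namespace LimitedModel

/-! ### Block structure and the singular value bound. -/

section Blocks

variable {q : ℕ} {n : Fin q → ℕ}

/-- The part of the state that belongs to subsystem `i`. -/
def blkVec (x : StateIdx n → ℝ) (i : Fin q) : Fin (n i) → ℝ := fun a => x ⟨i, a⟩

/-- The matrix has no nonzero block off the diagonal. -/
def IsBlockDiag (M : Mat n) : Prop := ∀ i j, i ≠ j → blk M i j = 0

theorem blkVec_mulVec (M : Mat n) (x : StateIdx n → ℝ) (i : Fin q) :
    blkVec (M *ᵥ x) i = ∑ j, blk M i j *ᵥ blkVec x j := by
  ext a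
  simp only [blkVec, Matrix.mulVec, dotProduct, Fintype.sum_sigma, Finset.sum_apply, blk,
    Matrix.of_apply]

theorem dotProduct_eq_sum_blkVec (x : StateIdx n → ℝ) :
    x ⬝ᵥ x = ∑ i, blkVec x i ⬝ᵥ blkVec x i := by
  simp only [dotProduct, Fintype.sum_sigma, blkVec]

theorem IsBlockDiag.blkVec_mulVec {M : Mat n} (hM : IsBlockDiag M) (x : StateIdx n → ℝ)
    (i : Fin q) : blkVec (M *ᵥ x) i = blk M i i *ᵥ blkVec x i := by
  rw [LimitedModel.blkVec_mulVec, Finset.sum_eq_single i]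
  · intro j _ hj
    rw [hM i j hj.symm, Matrix.zero_mulVec]
  · simp

theorem blk_blockDiagonal' (D : ∀ i, Matrix (Fin (n i)) (Fin (n i)) ℝ) (i : Fin q) :
    blk (Matrix.blockDiagonal' D) i i = D i := by
  ext a b
  simp [blk]

theorem isBlockDiag_blockDiagonal' (D : ∀ i, Matrix (Fin (n i)) (Fin (n i)) ℝ) :
    IsBlockDiag (Matrix.blockDiagonal' D) := by
  intro i j hij
  ext a b
  simp [blk, Matrix.blockDiagonal'_apply_ne _ _ _ hij]

/-- Expand in an orthonormal eigenbasis of `T* T`, whose eigenvalues are the squared singular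
values. -/
theorem singularValues_bound {E : Type*} [NormedAddCommGroup E] [InnerProductSpace ℝ E]
    [FiniteDimensional ℝ E] (T : E →ₗ[ℝ] E) {ε : ℝ} (hε : 0 ≤ ε)
    (h : ∀ k < Module.finrank ℝ E, ε ≤ T.singularValues k) (w : E) :
    ε ^ 2 * ‖w‖ ^ 2 ≤ ‖T w‖ ^ 2 := by
  have hsym := T.isSymmetric_adjoint_comp_self
  set b := hsym.eigenvectorBasis rfl
  have h1 : ‖T w‖ ^ 2 = ∑ i, hsym.eigenvalues rfl i * (inner ℝ (b i) w) ^ 2 := by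
    have : ‖T w‖ ^ 2 = inner ℝ w ((LinearMap.adjoint T ∘ₗ T) w) := by
      rw [LinearMap.comp_apply, LinearMap.adjoint_inner_right, real_inner_self_eq_norm_sq]
    rw [this, ← b.sum_inner_mul_inner w]
    refine Finset.sum_congr rfl fun i _ => ?_
    rw [← hsym (b i) w, hsym.apply_eigenvectorBasis, inner_smul_left, real_inner_comm]
    simp
    ring
  have h2 : ‖w‖ ^ 2 = ∑ i, (inner ℝ (b i) w) ^ 2 := by
    rw [← real_inner_self_eq_norm_sq, ← b.sum_inner_mul_inner w]
    refine Finset.sum_congr rfl fun i _ => ?_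
    rw [real_inner_comm, sq]
  rw [h1, h2, Finset.mul_sum]
  refine Finset.sum_le_sum fun i _ => mul_le_mul_of_nonneg_right ?_ (sq_nonneg _)
  rw [← T.sq_singularValues_fin rfl i]
  exact pow_le_pow_left₀ hε (h i i.2) 2

theorem sq_mul_dotProduct_le_of_mem_inputMatrices {ε : ℝ} (hε : 0 ≤ ε) {B : Mat n}
    (hB : B ∈ inputMatrices n ε) (w : StateIdx n → ℝ) :
    ε ^ 2 * (w ⬝ᵥ w) ≤ (B *ᵥ w) ⬝ᵥ (B *ᵥ w) := by
  have h := singularValues_bound (Matrix.toEuclideanLin B) hε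
    (by simpa [-Fintype.card_sigma] using hB.1) (WithLp.toLp 2 w)
  have hn : ∀ y : StateIdx n → ℝ, ‖(WithLp.toLp 2 y : EuclideanSpace ℝ (StateIdx n))‖ ^ 2 = y ⬝ᵥ y :=
    fun y => by
      rw [EuclideanSpace.norm_sq_eq]
      simp [dotProduct, sq]
  rw [hn] at h
  have h2 : Matrix.toEuclideanLin B (WithLp.toLp 2 w) = WithLp.toLp 2 (B *ᵥ w) := rfl
  rwa [h2, hn] at h

theorem sq_mul_dotProduct_le_of_mem_diagonalInputMatrices {ε : ℝ} (hε : 0 ≤ ε) {B : Mat n}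
    (hB : B ∈ diagonalInputMatrices n ε) (w : StateIdx n → ℝ) :
    ε ^ 2 * (w ⬝ᵥ w) ≤ (B *ᵥ w) ⬝ᵥ (B *ᵥ w) := by
  obtain ⟨d, rfl⟩ : ∃ d, B = Matrix.diagonal d := ⟨_, hB.1.diagonal_diag.symm⟩
  have hd := hB.2
  simp only [Matrix.diagonal_apply_eq] at hd
  simp only [dotProduct, Matrix.mulVec_diagonal, Finset.mul_sum]
  refine Finset.sum_le_sum fun k _ => ?_
  have := pow_le_pow_left₀ hε (hd k) 2
  nlinarith [sq_nonneg (w k)]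

theorem smul_one_mem_inputMatrices {ε : ℝ} (hε : 0 ≤ ε) : ε • (1 : Mat n) ∈ inputMatrices n ε := by
  constructor
  · intro k hk
    set T := Matrix.toEuclideanLin (ε • (1 : Mat n))
    have hT : T = ε • LinearMap.id := by
      ext x i
      simp [T, Matrix.toEuclideanLin]
    have hk' : k < Module.finrank ℝ (EuclideanSpace ℝ (StateIdx n)) := by
      rwa [finrank_euclideanSpace]
    obtain ⟨v, hv, hv0⟩ :=
      (T.hasEigenvalue_adjoint_comp_self_sq_singularValues hk').exists_hasEigenvector
    rw [Module.End.mem_eigenspace_iff] at hv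
    have h1 : (ε ^ 2) • v = (T.singularValues k ^ 2) • v := by
      refine Eq.trans ?_ hv
      rw [hT]
      simp [smul_smul, sq]
    have h2 := smul_left_injective ℝ hv0 h1
    exact (pow_left_inj₀ hε (T.singularValues_nonneg k) two_ne_zero).1 h2 |>.le
  · intro i j hij
    ext a b
    simp [blk, hij]

theorem smul_one_mem_diagonalInputMatrices (ε : ℝ) :
    ε • (1 : Mat n) ∈ diagonalInputMatrices n ε :=
  ⟨Matrix.isDiag_smul_one _ _, fun k => by simp⟩

theorem isBlockDiag_of_isDiag {B : Mat n} (hB : B.IsDiag) : IsBlockDiag B := by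
  intro i j hij
  ext a b
  exact hB fun h => hij (congrArg Sigma.fst h)

theorem isUnit_of_sq_mul_dotProduct_le {ι : Type*} [Fintype ι] [DecidableEq ι] {ε : ℝ}
    (hε : 0 < ε) {B : Matrix ι ι ℝ} (h : ∀ w, ε ^ 2 * (w ⬝ᵥ w) ≤ (B *ᵥ w) ⬝ᵥ (B *ᵥ w)) :
    IsUnit B := by
  rw [← Matrix.mulVec_injective_iff_isUnit]
  refine (injective_iff_map_eq_zero B.mulVecLin).2 fun w hw => ?_
  rw [Matrix.mulVecLin_apply] at hw
  have h1 := h w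
  rw [hw, zero_dotProduct] at h1
  refine dotProduct_self_eq_zero.1 (le_antisymm ?_ (dotProduct_self_nonneg' w))
  exact nonpos_of_mul_nonpos_right h1 (by positivity)

theorem IsBlockDiag.sq_mul_dotProduct_le {ε : ℝ} {B : Mat n} (hB : IsBlockDiag B)
    (h : ∀ w, ε ^ 2 * (w ⬝ᵥ w) ≤ (B *ᵥ w) ⬝ᵥ (B *ᵥ w)) (i : Fin q) (w : Fin (n i) → ℝ) :
    ε ^ 2 * (w ⬝ᵥ w) ≤ (blk B i i *ᵥ w) ⬝ᵥ (blk B i i *ᵥ w) := by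
  have h1 := h fun k => (Pi.single i w : ∀ j, Fin (n j) → ℝ) k.1 k.2
  have hb : ∀ j, blkVec (fun k : StateIdx n => (Pi.single i w : ∀ j, Fin (n j) → ℝ) k.1 k.2) j =
    (Pi.single i w : ∀ j, Fin (n j) → ℝ) j := fun j => rfl
  rw [dotProduct_eq_sum_blkVec, dotProduct_eq_sum_blkVec] at h1
  simp only [hB.blkVec_mulVec, hb] at h1
  rw [Finset.sum_eq_single i, Finset.sum_eq_single i] at h1
  · simpa using h1
  · intro j _ hj
    simp [Pi.single_eq_of_ne hj]
  · simp
  · intro j _ hj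
    simp [Pi.single_eq_of_ne hj]
  · simp

end Blocks

/-! ### The closed loop under `Γ^Θ`. -/

section GammaTheta

variable {q : ℕ} {n : Fin q → ℕ}

theorem riccatiSolution_spec {m : ℕ} (A : Matrix (Fin m) (Fin m) ℝ) {B : Matrix (Fin m) (Fin m) ℝ}
    (hB : IsUnit B) :
    (riccatiSolution A B).PosDef ∧ riccatiMap A B (riccatiSolution A B) = riccatiSolution A B := by
  have h : ∃ X : Matrix (Fin m) (Fin m) ℝ, X.PosDef ∧ IsRiccatiSolution A B X := by
    obtain ⟨X, hX, hfix⟩ := exists_riccati_fixedPoint A hB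
    exact ⟨X, hX, isRiccatiSolution_iff.2 hfix⟩
  exact ⟨(Classical.epsilon_spec h).1, isRiccatiSolution_iff.1 (Classical.epsilon_spec h).2⟩

open Classical in
/-- The block `D_i` of `Γ^Θ`. -/
noncomputable def blockGain (GP : Digraph (Fin q)) (A B : Mat n) (i : Fin q) :
    Matrix (Fin (n i)) (Fin (n i)) ℝ :=
  if IsSink GP i then lqrGain (blk A i i) (blk B i i) else (blk B i i)⁻¹

theorem blkVec_gammaTheta_mulVec (GP : Digraph (Fin q)) (A B : Mat n) (x : StateIdx n → ℝ)
    (i : Fin q) : blkVec (gammaTheta GP A B *ᵥ x) i =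
      -(blockGain GP A B i *ᵥ blkVec (A *ᵥ x) i) := by
  have : gammaTheta GP A B = -(Matrix.blockDiagonal' (blockGain GP A B) * A) := by
    rw [gammaTheta, Matrix.neg_mul]
    rfl
  rw [this, Matrix.neg_mulVec, ← Matrix.mulVec_mulVec]
  have h := (isBlockDiag_blockDiagonal' (blockGain GP A B)).blkVec_mulVec (A *ᵥ x) i
  rw [blk_blockDiagonal'] at h
  rw [← h]
  rfl

open Classical in
/-- The cost under `Γ^Θ` caused by the drift `v` of subsystem `i`. -/
noncomputable def blockCost (GP : Digraph (Fin q)) (A B : Mat n) (i : Fin q)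
    (v : Fin (n i) → ℝ) : ℝ :=
  if IsSink GP i then quadForm (stepMatrix (blk B i i) (riccatiSolution (blk A i i) (blk B i i))) v
  else ((blk B i i)⁻¹ *ᵥ v) ⬝ᵥ ((blk B i i)⁻¹ *ᵥ v)

variable {GP : Digraph (Fin q)} {A B : Mat n}

theorem blockCost_nonneg {i : Fin q} (hB : IsUnit (blk B i i)) (v : Fin (n i) → ℝ) :
    0 ≤ blockCost GP A B i v := by
  rw [blockCost]
  split_ifs
  · exact quadForm_nonneg
      (stepMatrix_posSemidef (riccatiSolution_spec (blk A i i) hB).1.posSemidef _) _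
  · exact dotProduct_self_nonneg' _

theorem blockCost_le {i : Fin q} (hB : IsUnit (blk B i i)) (v : Fin (n i) → ℝ) :
    blockCost GP A B i v ≤ ((blk B i i)⁻¹ *ᵥ v) ⬝ᵥ ((blk B i i)⁻¹ *ᵥ v) := by
  rw [blockCost]
  split_ifs
  · exact stepMatrix_le_inv (riccatiSolution_spec (blk A i i) hB).1.posSemidef hB v
  · exact le_rfl

theorem add_mulVec_blockGain_of_not_isSink {i : Fin q} (hB : IsUnit (blk B i i))
    (hi : ¬ IsSink GP i) (v : Fin (n i) → ℝ) :
    v + blk B i i *ᵥ (-(blockGain GP A B i *ᵥ v)) = 0 := by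
  rw [blockGain, if_neg hi, Matrix.mulVec_neg, Matrix.mulVec_mulVec,
    Matrix.mul_nonsing_inv _ ((Matrix.isUnit_iff_isUnit_det _).1 hB), Matrix.one_mulVec]
  exact add_neg_cancel v

/-- For a sink this is the Bellman equation of its own LQR problem; for a non-sink `y = 0` and only
the input energy remains. -/
theorem blockCost_step {i : Fin q} (hB : IsUnit (blk B i i)) (v y w : Fin (n i) → ℝ)
    (hw : w = -(blockGain GP A B i *ᵥ v)) (hy : y = v + blk B i i *ᵥ w) :
    y ⬝ᵥ y + w ⬝ᵥ w + blockCost GP A B i (blk A i i *ᵥ y) = blockCost GP A B i v := by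
  by_cases hi : IsSink GP i
  · obtain ⟨hX, hfix⟩ := riccatiSolution_spec (blk A i i) hB
    have hq := quadForm_riccatiMap (blk A i i) (blk B i i)
      (riccatiSolution (blk A i i) (blk B i i)) y
    rw [hfix] at hq
    have hs := stepMatrix_eq hX.posSemidef (blk B i i) v
    have hg : blockGain GP A B i =
        feedbackGain (blk B i i) (riccatiSolution (blk A i i) (blk B i i)) := by
      rw [blockGain, if_pos hi]
      rfl
    rw [← hg, ← hw, ← hy] at hs
    simp only [blockCost, if_pos hi]
    linarith
  · have hy0 : y = 0 := by
      rw [hy, hw, add_mulVec_blockGain_of_not_isSink hB hi]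
    have hw' : w = -((blk B i i)⁻¹ *ᵥ v) := by rw [hw, blockGain, if_neg hi]
    simp [blockCost, if_neg hi, hy0, hw']

theorem blk_eq_zero_of_isSink (hA : A ∈ structuredMatrices n GP) {i j : Fin q} (hj : IsSink GP j)
    (hij : i ≠ j) : blk A i j = 0 :=
  hA i j (adjacency_eq_zero_iff.2 (hj i hij))

theorem cost_gammaTheta_le (hA : A ∈ structuredMatrices n GP) (hBd : IsBlockDiag B)
    (hB : ∀ i, IsUnit (blk B i i)) (x₀ : StateIdx n → ℝ) :
    cost A B x₀ (gammaTheta GP A B) ≤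
      ENNReal.ofReal (∑ i, blockCost GP A B i (blkVec (A *ᵥ x₀) i)) := by
  refine cost_le_of_potential (fun x => ∑ i, blockCost GP A B i (blkVec (A *ᵥ x) i))
    (fun x => Finset.sum_nonneg fun i _ => blockCost_nonneg (hB i) _) (fun x => ?_) x₀
  set u := gammaTheta GP A B *ᵥ x with hu
  set y := A *ᵥ x + B *ᵥ u with hy
  have hui : ∀ i, blkVec u i = -(blockGain GP A B i *ᵥ blkVec (A *ᵥ x) i) :=
    blkVec_gammaTheta_mulVec GP A B x
  have hyi : ∀ i, blkVec y i = blkVec (A *ᵥ x) i + blk B i i *ᵥ blkVec u i := fun i => by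
    rw [← hBd.blkVec_mulVec]
    rfl
  -- Decoupling after one step: for `j ≠ i`, either `j` is a sink and `A_ij = 0`, or deadbeat has
  -- made `y_j = 0`.
  have hAy : ∀ i, blkVec (A *ᵥ y) i = blk A i i *ᵥ blkVec y i := by
    intro i
    rw [blkVec_mulVec, Finset.sum_eq_single i]
    · intro j _ hj
      by_cases hs : IsSink GP j
      · rw [blk_eq_zero_of_isSink hA hs hj.symm, Matrix.zero_mulVec]
      · rw [hyi, hui, add_mulVec_blockGain_of_not_isSink (hB j) hs, Matrix.mulVec_zero]
    · simp
  rw [dotProduct_eq_sum_blkVec, dotProduct_eq_sum_blkVec u, ← Finset.sum_add_distrib,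
    ← Finset.sum_add_distrib]
  refine Finset.sum_le_sum fun i _ => ?_
  rw [hAy]
  exact (blockCost_step (hB i) _ _ _ (hui i) (hyi i)).le

theorem gammaTheta_mem_designMethods (GP : Digraph (Fin q)) (𝓑 : Set (Mat n)) :
    gammaTheta GP ∈ designMethods n GP ⊤ (selfLoops q) 𝓑 := by
  refine ⟨fun A _ B _ => by rw [structuredMatrices_top]; trivial, ?_⟩
  intro i A _ B _ A' _ B' _ h l
  obtain ⟨hA, hB⟩ := h i (by rw [ne_eq, adjacency_eq_zero_iff, not_not]; rfl)
  have key : ∀ A B : Mat n, blk (gammaTheta GP A B) i l = -(blockGain GP A B i * blk A i l) := by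
    intro A B
    ext a b
    have h1 := congrFun (blkVec_gammaTheta_mulVec GP A B (Pi.single ⟨l, b⟩ 1) i) a
    have h2 : blkVec (A *ᵥ Pi.single ⟨l, b⟩ 1) i = fun c => blk A i l c b := by
      ext c
      simp [blkVec, blk]
    rw [h2] at h1
    have h3 : blkVec (gammaTheta GP A B *ᵥ Pi.single ⟨l, b⟩ 1) i a =
        blk (gammaTheta GP A B) i l a b := by
      simp [blkVec, blk]
    rw [← h3, h1]
    rfl
  rw [key, key, hA l]
  simp only [blockGain, hA i, hB]

end GammaTheta

end LimitedModel

namespace LimitedModel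

/-! ### Upper bounds: comparison with the first stage of an arbitrary gain. -/

section UpperBounds

variable {q : ℕ} {n : Fin q → ℕ} {GP : Digraph (Fin q)} {A B : Mat n}

theorem inv_dotProduct_le {ι : Type*} [Fintype ι] [DecidableEq ι] {ε : ℝ} (hε : 0 < ε)
    {B : Matrix ι ι ℝ} (h : ∀ w, ε ^ 2 * (w ⬝ᵥ w) ≤ (B *ᵥ w) ⬝ᵥ (B *ᵥ w)) (v u : ι → ℝ) :
    (B⁻¹ *ᵥ v) ⬝ᵥ (B⁻¹ *ᵥ v) ≤
      (1 + 1 / ε ^ 2) * ((v + B *ᵥ u) ⬝ᵥ (v + B *ᵥ u) + u ⬝ᵥ u) := by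
  have hB := (Matrix.isUnit_iff_isUnit_det _).1 (isUnit_of_sq_mul_dotProduct_le hε h)
  set w := B⁻¹ *ᵥ v with hw
  have hv : v + B *ᵥ u = B *ᵥ (w + u) := by
    rw [Matrix.mulVec_add, hw, Matrix.mulVec_mulVec, Matrix.mul_nonsing_inv _ hB, Matrix.one_mulVec]
  have h1 : w ⬝ᵥ w ≤ (1 + 1 / ε ^ 2) * (ε ^ 2 * ((w + u) ⬝ᵥ (w + u)) + u ⬝ᵥ u) := by
    simp only [dotProduct, Finset.mul_sum, ← Finset.sum_add_distrib]
    refine Finset.sum_le_sum fun i _ => ?_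
    -- The equality case of this Cauchy–Schwarz inequality for `w = (w + u) - u` is where the
    -- constant `1 + 1/ε²` comes from.
    have h2 : (1 + 1 / ε ^ 2) * (ε ^ 2 * ((w + u) i * (w + u) i) + u i * u i) - w i * w i =
        (ε * (w i + u i) + u i / ε) ^ 2 := by
      simp only [Pi.add_apply]
      field_simp
      ring
    have := sq_nonneg (ε * (w i + u i) + u i / ε)
    linarith
  refine h1.trans (mul_le_mul_of_nonneg_left ?_ (by positivity))
  rw [hv]
  exact add_le_add (h _) le_rfl

theorem cost_gammaTheta_le_mul_cost {ε c : ℝ} (hc : 0 ≤ c) (hε : 0 < ε)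
    (hA : A ∈ structuredMatrices n GP) (hBd : IsBlockDiag B)
    (hB : ∀ w, ε ^ 2 * (w ⬝ᵥ w) ≤ (B *ᵥ w) ⬝ᵥ (B *ᵥ w)) (x₀ : StateIdx n → ℝ) (K : Mat n)
    (h : ∀ i (u : Fin (n i) → ℝ), blockCost GP A B i (blkVec (A *ᵥ x₀) i) ≤
      c * ((blkVec (A *ᵥ x₀) i + blk B i i *ᵥ u) ⬝ᵥ (blkVec (A *ᵥ x₀) i + blk B i i *ᵥ u) +
        u ⬝ᵥ u)) :
    cost A B x₀ (gammaTheta GP A B) ≤ ENNReal.ofReal c * cost A B x₀ K := by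
  refine (cost_gammaTheta_le hA hBd (fun i => isUnit_of_sq_mul_dotProduct_le hε
    (hBd.sq_mul_dotProduct_le hB i)) x₀).trans ?_
  refine le_trans ?_ (mul_le_mul_right (first_stage_le_cost A B K x₀) _)
  rw [← ENNReal.ofReal_mul hc]
  refine ENNReal.ofReal_le_ofReal ?_
  rw [dotProduct_eq_sum_blkVec, dotProduct_eq_sum_blkVec (K *ᵥ x₀), ← Finset.sum_add_distrib,
    Finset.mul_sum]
  refine Finset.sum_le_sum fun i _ => (h i (blkVec (K *ᵥ x₀) i)).trans_eq ?_
  rw [← hBd.blkVec_mulVec]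
  rfl

theorem blockCost_le_mul {ε : ℝ} (hε : 0 < ε) {i : Fin q}
    (hB : ∀ w, ε ^ 2 * (w ⬝ᵥ w) ≤ (blk B i i *ᵥ w) ⬝ᵥ (blk B i i *ᵥ w)) (v u : Fin (n i) → ℝ) :
    blockCost GP A B i v ≤
      (1 + 1 / ε ^ 2) * ((v + blk B i i *ᵥ u) ⬝ᵥ (v + blk B i i *ᵥ u) + u ⬝ᵥ u) :=
  (blockCost_le (isUnit_of_sq_mul_dotProduct_le hε hB) v).trans (inv_dotProduct_le hε hB v u)

/-- With `A_ii = 0` the Riccati equation forces `X = I`, so the block cost is the minimum of the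
first stage alone. -/
theorem blockCost_le_of_isSink {i : Fin q} (hi : IsSink GP i) (hAi : blk A i i = 0)
    (hB : IsUnit (blk B i i)) (v u : Fin (n i) → ℝ) :
    blockCost GP A B i v ≤ (v + blk B i i *ᵥ u) ⬝ᵥ (v + blk B i i *ᵥ u) + u ⬝ᵥ u := by
  obtain ⟨hX, hfix⟩ := riccatiSolution_spec (blk A i i) hB
  rw [blockCost, if_pos hi]
  have h := stepMatrix_le hX.posSemidef (blk B i i) v u
  have hX1 : riccatiSolution (blk A i i) (blk B i i) = 1 := by
    rw [← hfix, riccatiMap, hAi, Matrix.mul_zero, add_zero]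
  have h1 : ∀ y : Fin (n i) → ℝ, quadForm 1 y = y ⬝ᵥ y := fun y => by simp [quadForm]
  nth_rw 2 [hX1] at h
  rw [h1] at h
  linarith

theorem blkVec_eq_zero_of_not_isSink (hA : A ∈ structuredMatrices n GP) (h : adjacency₁₁ GP = 0)
    {i : Fin q} (hi : ¬ IsSink GP i) (x : StateIdx n → ℝ) : blkVec (A *ᵥ x) i = 0 := by
  rw [blkVec_mulVec]
  refine Finset.sum_eq_zero fun j _ => ?_
  rw [hA i j, Matrix.zero_mulVec]
  by_cases hj : IsSink GP j
  · exact adjacency_eq_zero_iff.2 (hj i fun hij => hi (hij ▸ hj))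
  · exact congrFun (congrFun h ⟨i, hi⟩) ⟨j, hj⟩

theorem blockCost_le_of_adjacency_eq_zero {ε : ℝ} (hε : 0 < ε)
    (hA : A ∈ structuredMatrices n GP) (h₁ : adjacency₁₁ GP = 0) (h₂ : adjacency₂₂ GP = 0)
    {i : Fin q} (hB : ∀ w, ε ^ 2 * (w ⬝ᵥ w) ≤ (blk B i i *ᵥ w) ⬝ᵥ (blk B i i *ᵥ w))
    (x : StateIdx n → ℝ) (u : Fin (n i) → ℝ) :
    blockCost GP A B i (blkVec (A *ᵥ x) i) ≤
      (blkVec (A *ᵥ x) i + blk B i i *ᵥ u) ⬝ᵥ (blkVec (A *ᵥ x) i + blk B i i *ᵥ u) + u ⬝ᵥ u := by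
  have hBu := isUnit_of_sq_mul_dotProduct_le hε hB
  by_cases hi : IsSink GP i
  · exact blockCost_le_of_isSink hi (hA i i (congrFun (congrFun h₂ ⟨i, hi⟩) ⟨i, hi⟩)) hBu _ _
  · refine (blockCost_le hBu _).trans ?_
    rw [blkVec_eq_zero_of_not_isSink hA h₁ hi, Matrix.mulVec_zero, zero_dotProduct]
    exact add_nonneg (dotProduct_self_nonneg' _) (dotProduct_self_nonneg' _)

end UpperBounds

/-! ### Lower bounds: extremal families of plants with `B = εI`. -/

section LowerBounds

open Filter Topology

variable {q : ℕ} {n : Fin q → ℕ} {GP : Digraph (Fin q)}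

theorem single_mem_structuredMatrices {i j : Fin q} (h : GP.Adj j i) (k : Fin (n i))
    (l : Fin (n j)) (a : ℝ) :
    (Matrix.single ⟨i, k⟩ ⟨j, l⟩ a : Mat n) ∈ structuredMatrices n GP := by
  intro i' j' h'
  ext c d
  refine Matrix.single_apply_of_ne _ _ _ _ _ ?_
  rintro ⟨h1, h2⟩
  cases h1
  cases h2
  exact adjacency_eq_zero_iff.1 h' h

theorem add_mem_structuredMatrices {A A' : Mat n} (hA : A ∈ structuredMatrices n GP)
    (hA' : A' ∈ structuredMatrices n GP) : A + A' ∈ structuredMatrices n GP := by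
  intro i j h
  have h1 : blk (A + A') i j = blk A i j + blk A' i j := rfl
  rw [h1, hA i j h, hA' i j h, add_zero]

theorem single_mulVec_apply {ι : Type*} [Fintype ι] [DecidableEq ι] (p s : ι) (a : ℝ) (x : ι → ℝ) :
    Matrix.single p s a *ᵥ x = Pi.single p (a * x s) := by
  rw [Matrix.single_mulVec]
  rfl

theorem sq_le_dotProduct_self {ι : Type*} [Fintype ι] (x : ι → ℝ) (i : ι) : x i ^ 2 ≤ x ⬝ᵥ x := by
  rw [sq]
  exact Finset.single_le_sum (f := fun j => x j * x j) (fun j _ => mul_self_nonneg _)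
    (Finset.mem_univ i)

theorem blk_smul_one (ε : ℝ) (i : Fin q) : blk (ε • (1 : Mat n)) i i = ε • 1 := by
  ext a b
  simp [blk, Matrix.one_apply, Sigma.mk.injEq]

theorem gammaTheta_mulVec_apply_of_not_isSink {ε : ℝ} (hε : ε ≠ 0) (A : Mat n) {i : Fin q}
    (hi : ¬ IsSink GP i) (x : StateIdx n → ℝ) (k : Fin (n i)) :
    (gammaTheta GP A (ε • 1) *ᵥ x) ⟨i, k⟩ = -(ε⁻¹ * (A *ᵥ x) ⟨i, k⟩) := by
  have h := congrFun (blkVec_gammaTheta_mulVec GP A (ε • 1) x i) k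
  have hinv : (ε • (1 : Matrix (Fin (n i)) (Fin (n i)) ℝ))⁻¹ = ε⁻¹ • 1 := by
    refine Matrix.inv_eq_right_inv ?_
    simp [smul_smul, hε]
  rw [blockGain, if_neg hi, blk_smul_one, hinv, Matrix.smul_mulVec, Matrix.one_mulVec] at h
  simpa [blkVec] using h

theorem gammaTheta_mulVec_apply_eq_zero (A B : Mat n) {i : Fin q} {x : StateIdx n → ℝ}
    (hx : ∀ k : Fin (n i), (A *ᵥ x) ⟨i, k⟩ = 0) (k : Fin (n i)) :
    (gammaTheta GP A B *ᵥ x) ⟨i, k⟩ = 0 := by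
  have h := congrFun (blkVec_gammaTheta_mulVec GP A B x i) k
  have h0 : blkVec (A *ᵥ x) i = 0 := funext hx
  simpa [h0, blkVec] using h

theorem le_of_tendsto_ofReal {l : Filter ℝ} [l.NeBot] {f : ℝ → ℝ} {c : ℝ} {r : ℝ≥0∞}
    (hf : Tendsto f l (𝓝 c)) (h : ∀ᶠ a in l, ENNReal.ofReal (f a) ≤ r) : ENNReal.ofReal c ≤ r :=
  le_of_tendsto (ENNReal.tendsto_ofReal hf) h

variable {𝓑 : Set (Mat n)} {Kstar : Mat n → Mat n → (StateIdx n → ℝ) → Mat n}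

/-- With the single entry `a` on the edge, deadbeat spends at least `a²/ε²`, while the one-stage
least squares gain costs about `a²/(1 + ε²)`. Letting `a → 0` makes later stages negligible when the
edge is a self-loop. -/
theorem le_competitiveRatio_of_adj_not_isSink {ε : ℝ} (hε : 0 < ε) (hn : ∀ i, 1 ≤ n i)
    (hB : ε • (1 : Mat n) ∈ 𝓑) (hK : IsOptimalStrategy n GP ⊤ 𝓑 Kstar) {i j : Fin q}
    (hij : GP.Adj j i) (hi : ¬ IsSink GP i) :
    ENNReal.ofReal (1 + 1 / ε ^ 2) ≤ competitiveRatio n GP 𝓑 Kstar (gammaTheta GP) := by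
  have hlim : Tendsto (fun a : ℝ => (1 + 1 / ε ^ 2) * (1 - a ^ 2)) (𝓝[>] 0)
      (𝓝 (1 + 1 / ε ^ 2)) := by
    have h : Continuous fun a : ℝ => (1 + 1 / ε ^ 2) * (1 - a ^ 2) := by fun_prop
    have := h.tendsto 0
    simp only [ne_eq, OfNat.ofNat_ne_zero, not_false_eq_true, zero_pow, sub_zero, mul_one] at this
    exact this.mono_left nhdsWithin_le_nhds
  refine le_of_tendsto_ofReal hlim ?_
  filter_upwards [Ioo_mem_nhdsGT (zero_lt_one (α := ℝ))] with a ⟨ha0, ha1⟩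
  set p : StateIdx n := ⟨i, ⟨0, hn i⟩⟩ with hp
  set s : StateIdx n := ⟨j, ⟨0, hn j⟩⟩ with hs
  set A : Mat n := Matrix.single p s a with hAdef
  have ha2 : 0 < 1 - a ^ 2 := by nlinarith
  have hAx : ∀ x, A *ᵥ x = Pi.single p (a * x s) := single_mulVec_apply p s a
  -- The solution of `c = a²/(1 + ε²) + c a²`, a geometric series that covers `p = s` and `p ≠ s`
  -- together.
  set c : ℝ := a ^ 2 / (1 + ε ^ 2) / (1 - a ^ 2) with hc
  have hΓ : ENNReal.ofReal (a ^ 2 / ε ^ 2) ≤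
      cost A (ε • 1) (Pi.single s 1) (gammaTheta GP A (ε • 1)) := by
    refine le_trans (ENNReal.ofReal_le_ofReal ?_) (first_stage_le_cost _ _ _ _)
    refine le_trans ?_ (le_add_of_nonneg_left (dotProduct_self_nonneg' _))
    refine le_trans (le_of_eq ?_) (sq_le_dotProduct_self _ p)
    rw [hp, gammaTheta_mulVec_apply_of_not_isSink hε.ne' A hi, hAx, ← hp]
    simp
    field_simp
  have hKb : cost A (ε • 1) (Pi.single s 1) (-((ε / (1 + ε ^ 2)) • A)) ≤ ENNReal.ofReal c := by
    have h := cost_le_of_potential (A := A) (B := ε • 1) (K := -((ε / (1 + ε ^ 2)) • A))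
      (fun x => c * x s ^ 2) (fun x => by positivity) (fun x => ?_) (Pi.single s 1)
    · simpa using h
    have hu : (-((ε / (1 + ε ^ 2)) • A)) *ᵥ x = Pi.single p (-(ε / (1 + ε ^ 2) * (a * x s))) := by
      rw [Matrix.neg_mulVec, Matrix.smul_mulVec, hAx, Pi.single_neg, ← Pi.single_smul, smul_eq_mul]
    have hy : A *ᵥ x + (ε • (1 : Mat n)) *ᵥ Pi.single p (-(ε / (1 + ε ^ 2) * (a * x s))) =
        Pi.single p (a * x s / (1 + ε ^ 2)) := by
      rw [hAx, Matrix.smul_mulVec, Matrix.one_mulVec, ← Pi.single_smul, ← Pi.single_add]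
      congr 1
      simp only [smul_eq_mul]
      field_simp
      ring
    have hsq : (Pi.single p (a * x s / (1 + ε ^ 2)) : StateIdx n → ℝ) s ^ 2 ≤ a ^ 2 * x s ^ 2 := by
      refine (sq_le_dotProduct_self _ s).trans ?_
      simp only [dotProduct_single, Pi.single_eq_same]
      have : (a * x s / (1 + ε ^ 2)) * (a * x s / (1 + ε ^ 2)) =
          a ^ 2 * x s ^ 2 / (1 + ε ^ 2) ^ 2 := by
        field_simp
      rw [this]
      refine div_le_self (by positivity) ?_
      nlinarith [sq_nonneg ε, sq_nonneg (ε ^ 2)]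
    rw [hu, hy]
    have hc0 : 0 ≤ c := by positivity
    have h1 := mul_le_mul_of_nonneg_left hsq hc0
    have h2 : c * (a ^ 2 * x s ^ 2) = c * x s ^ 2 - a ^ 2 * x s ^ 2 / (1 + ε ^ 2) := by
      rw [hc]
      field_simp
      ring
    have h3 : (Pi.single p (a * x s / (1 + ε ^ 2)) : StateIdx n → ℝ) ⬝ᵥ
          Pi.single p (a * x s / (1 + ε ^ 2)) +
        (Pi.single p (-(ε / (1 + ε ^ 2) * (a * x s))) : StateIdx n → ℝ) ⬝ᵥ
          Pi.single p (-(ε / (1 + ε ^ 2) * (a * x s))) = a ^ 2 * x s ^ 2 / (1 + ε ^ 2) := by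
      simp only [dotProduct_single, Pi.single_eq_same]
      field_simp
    rw [h3]
    linarith
  have hfin := le_competitiveRatio hK (single_mem_structuredMatrices hij _ _ a) hB
    (Pi.single s 1) _ (by positivity) (by positivity) hΓ hKb
  refine le_trans (le_of_eq ?_) hfin
  rw [hc]
  congr 1
  field_simp
  ring

/-- Take self-loop gain `a`, link gain `a²` and `a → ∞`. Under `Γ^Θ` the neighbour stays at 0, so
the sink faces a scalar unstable plant and spends about `a²/ε²`. A coordinated gain costs about
`a²/(1 + ε²)`: it places the neighbour at a state of order 1 that annihilates the next drift of the
sink. -/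
theorem le_competitiveRatio_of_isSink_adj_self {ε : ℝ} (hε : 0 < ε) (hn : ∀ i, 1 ≤ n i)
    (hB : ε • (1 : Mat n) ∈ 𝓑) (hK : IsOptimalStrategy n GP ⊤ 𝓑 Kstar) {i j : Fin q}
    (hii : GP.Adj i i) (hij : GP.Adj j i) (hne : j ≠ i) :
    ENNReal.ofReal (1 + 1 / ε ^ 2) ≤ competitiveRatio n GP 𝓑 Kstar (gammaTheta GP) := by
  set κ : ℝ := (1 + 1 / ε ^ 2) / (1 + ε ^ 2) ^ 2 with hκ
  have hlim : Tendsto (fun a : ℝ => ((1 + a ^ 2 / (1 + ε ^ 2))⁻¹ + ε ^ 2)⁻¹ /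
      (1 / (1 + ε ^ 2) + (a ^ 2)⁻¹ * κ)) atTop (𝓝 (1 + 1 / ε ^ 2)) := by
    have h2 : Tendsto (fun a : ℝ => a ^ 2) atTop atTop := tendsto_pow_atTop two_ne_zero
    have hM : Tendsto (fun a : ℝ => (1 + a ^ 2 / (1 + ε ^ 2))⁻¹) atTop (𝓝 0) :=
      (tendsto_atTop_add_const_left _ 1 (h2.atTop_div_const (by positivity))).inv_tendsto_atTop
    have h := ((hM.add_const (ε ^ 2)).inv₀ (by positivity)).div
      ((h2.inv_tendsto_atTop.mul_const κ).const_add (1 / (1 + ε ^ 2))) (by positivity)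
    have hl : (0 + ε ^ 2)⁻¹ / (1 / (1 + ε ^ 2) + 0 * κ) = 1 + 1 / ε ^ 2 := by
      field_simp
      ring
    rw [hl] at h
    exact h
  refine le_of_tendsto_ofReal hlim ?_
  filter_upwards [eventually_gt_atTop 0] with a ha
  set p : StateIdx n := ⟨i, ⟨0, hn i⟩⟩ with hp
  set s : StateIdx n := ⟨j, ⟨0, hn j⟩⟩ with hs
  have hps : p ≠ s := fun h => hne (congrArg Sigma.fst h).symm
  set A : Mat n := Matrix.single p p a + Matrix.single p s (a ^ 2) with hAdef
  have hAx : ∀ x, A *ᵥ x = Pi.single p (a * x p + a ^ 2 * x s) := fun x => by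
    rw [hAdef, Matrix.add_mulVec, single_mulVec_apply, single_mulVec_apply, Pi.single_add]
  have hΓ : ENNReal.ofReal (a ^ 2 * ((1 + a ^ 2 / (1 + ε ^ 2))⁻¹ + ε ^ 2)⁻¹) ≤
      cost A (ε • 1) (Pi.single p 1) (gammaTheta GP A (ε • 1)) := by
    refine le_trans (ENNReal.ofReal_le_ofReal ?_) (sum_stage_le_cost _ _ _ _ 2)
    set K := gammaTheta GP A (ε • 1) with hKdef
    set x : ℕ → StateIdx n → ℝ := trajectory A (ε • 1) K (Pi.single p 1) with hx
    have hx0 : x 0 = Pi.single p 1 := rfl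
    have hstep : ∀ k l, x (k + 1) l = (A *ᵥ x k) l + ε * (K *ᵥ x k) l := fun k l => by
      simp only [hx, trajectory, Matrix.smul_mulVec, Matrix.one_mulVec, Pi.add_apply, Pi.smul_apply,
        smul_eq_mul]
    have hA0 : A *ᵥ x 0 = Pi.single p a := by
      rw [hAx, hx0]
      simp [hps.symm]
    have hu0 : (K *ᵥ x 0) s = 0 := by
      refine gammaTheta_mulVec_apply_eq_zero A _ (fun k => ?_) _
      rw [hA0]
      exact Pi.single_eq_of_ne (fun h => hne (congrArg Sigma.fst h)) _
    have hx1s : x 1 s = 0 := by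
      rw [hstep 0 s, hu0, hA0, Pi.single_eq_of_ne hps.symm]
      simp
    have hx1p : x 1 p = a + ε * (K *ᵥ x 0) p := by
      rw [hstep 0 p, hA0, Pi.single_eq_same]
    have hx2p : x 2 p = a * x 1 p + ε * (K *ᵥ x 1) p := by
      rw [hstep 1 p, hAx, Pi.single_eq_same, hx1s]
      ring
    have b1 := sq_le_dotProduct_self (x 1) p
    have b2 := sq_le_dotProduct_self (x 2) p
    have b3 := sq_le_dotProduct_self (K *ᵥ x 0) p
    have b4 := sq_le_dotProduct_self (K *ᵥ x 1) p
    rw [Finset.sum_range_succ, Finset.sum_range_one]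
    generalize (K *ᵥ x 0) p = u at *
    generalize (K *ᵥ x 1) p = w at *
    generalize x 1 p = y at *
    -- Two-stage dynamic programming backwards: first minimize over the second input `w`, then over
    -- `u` with weight `m` on `y²`.
    have hw : y ^ 2 * (a ^ 2 / (1 + ε ^ 2)) ≤ x 2 p ^ 2 + w ^ 2 := by
      have : x 2 p ^ 2 + w ^ 2 - y ^ 2 * (a ^ 2 / (1 + ε ^ 2)) =
          (ε * a * y + (1 + ε ^ 2) * w) ^ 2 / (1 + ε ^ 2) := by
        rw [hx2p]
        field_simp
        ring
      have : 0 ≤ (ε * a * y + (1 + ε ^ 2) * w) ^ 2 / (1 + ε ^ 2) := by positivity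
      linarith
    set m : ℝ := 1 + a ^ 2 / (1 + ε ^ 2) with hm
    have hm0 : 0 < m := by positivity
    have hu : a ^ 2 * (m⁻¹ + ε ^ 2)⁻¹ ≤ u ^ 2 + m * y ^ 2 := by
      have : u ^ 2 + m * y ^ 2 - a ^ 2 * (m⁻¹ + ε ^ 2)⁻¹ =
          (m * ε * a + (1 + m * ε ^ 2) * u) ^ 2 / (1 + m * ε ^ 2) := by
        rw [hx1p]
        field_simp
        ring
      have : 0 ≤ (m * ε * a + (1 + m * ε ^ 2) * u) ^ 2 / (1 + m * ε ^ 2) := by positivity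
      linarith
    have : m * y ^ 2 = y ^ 2 + y ^ 2 * (a ^ 2 / (1 + ε ^ 2)) := by rw [hm]; ring
    change _ ≤ x 1 ⬝ᵥ x 1 + (K *ᵥ x 0) ⬝ᵥ (K *ᵥ x 0) + (x 2 ⬝ᵥ x 2 + (K *ᵥ x 1) ⬝ᵥ (K *ᵥ x 1))
    linarith
  -- At `p`, one-stage least squares moves the drift `z` to `z/(1 + ε²)`. At `s`, the input yields
  -- the state `-z/(a(1 + ε²))`, so that `a x_p + a² x_s = 0` at the next step. The cost at `s` is
  -- `κ z²/a²`.
  set K : Mat n := -((ε / (1 + ε ^ 2)) • A) - (1 / (a * ε * (1 + ε ^ 2))) •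
    (Matrix.single s p a + Matrix.single s s (a ^ 2)) with hKdef
  have hKb : cost A (ε • 1) (Pi.single p 1) K ≤
      ENNReal.ofReal (a ^ 2 * (1 / (1 + ε ^ 2) + (a ^ 2)⁻¹ * κ)) := by
    have h := cost_le_of_potential (A := A) (B := ε • 1) (K := K)
      (fun x => (1 / (1 + ε ^ 2) + (a ^ 2)⁻¹ * κ) * (a * x p + a ^ 2 * x s) ^ 2)
      (fun x => by positivity) (fun x => ?_) (Pi.single p 1)
    · refine h.trans_eq ?_
      simp [hps.symm]
      ring_nf
    set z := a * x p + a ^ 2 * x s with hz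
    have hu : K *ᵥ x = (Pi.single (M := fun _ => ℝ) p (-(ε / (1 + ε ^ 2) * z)) +
        Pi.single (M := fun _ => ℝ) s (-(1 / (a * ε * (1 + ε ^ 2)) * z)) : StateIdx n → ℝ) := by
      rw [hKdef, Matrix.sub_mulVec, Matrix.neg_mulVec, Matrix.smul_mulVec, hAx, Matrix.smul_mulVec,
        Matrix.add_mulVec, single_mulVec_apply, single_mulVec_apply, ← Pi.single_add,
        ← Pi.single_smul, ← Pi.single_smul, Pi.single_neg, Pi.single_neg, smul_eq_mul, smul_eq_mul,
        sub_eq_add_neg]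
    have hy : A *ᵥ x + (ε • (1 : Mat n)) *ᵥ (K *ᵥ x) =
        (Pi.single (M := fun _ => ℝ) p (z / (1 + ε ^ 2)) + Pi.single (M := fun _ => ℝ) s (-(z / (a * (1 + ε ^ 2)))) : StateIdx n → ℝ) := by
      rw [hu, hAx, Matrix.smul_mulVec, Matrix.one_mulVec, smul_add, ← Pi.single_smul,
        ← Pi.single_smul, ← add_assoc, ← Pi.single_add]
      congr 2
      · simp only [smul_eq_mul]
        rw [← hz]
        field_simp
        ring
      · simp only [smul_eq_mul]
        field_simp
    have hdot : ∀ α β : ℝ, (Pi.single p α + Pi.single s β : StateIdx n → ℝ) ⬝ᵥ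
        (Pi.single p α + Pi.single s β) = α ^ 2 + β ^ 2 := fun α β => by
      simp [hps, hps.symm, dotProduct_add, sq]
    rw [hy, hu, hdot, hdot]
    simp only [Pi.add_apply, Pi.single_eq_same, Pi.single_eq_of_ne hps, Pi.single_eq_of_ne hps.symm]
    refine le_of_eq ?_
    rw [hκ]
    field_simp
    ring
  have hA : A ∈ structuredMatrices n GP := add_mem_structuredMatrices
    (single_mem_structuredMatrices hii _ _ _) (single_mem_structuredMatrices hij _ _ _)
  have hfin := le_competitiveRatio hK hA hB (Pi.single p 1) K (by positivity) (by positivity) hΓ hKb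
  rwa [mul_div_mul_left _ _ (by positivity)] at hfin

end LowerBounds

end LimitedModel

/-! ### Assembly of the theorem. -/

theorem mainTheorem4 {q : ℕ} (n : Fin q → ℕ) (hn : ∀ i, 1 ≤ n i)
    (GP GK : Digraph (Fin q)) (ε : ℝ) (hε : 0 < ε)
    (hisolated : ∀ i, ¬ LimitedModel.IsIsolated GP i)
    (hsink : ∃ i, LimitedModel.IsSink GP i)
    (hGK : GK = ⊤)
    (𝓑 : Set (LimitedModel.Mat n))
    (h𝓑 : 𝓑 = LimitedModel.inputMatrices n ε ∨ 𝓑 = LimitedModel.diagonalInputMatrices n ε) :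
    -- the Riccati equations in the definition of `Γ^Θ` have unique positive definite solutions
    (∀ A ∈ LimitedModel.structuredMatrices n GP, ∀ B ∈ 𝓑, ∀ i, LimitedModel.IsSink GP i →
      ∃! X : Matrix (Fin (n i)) (Fin (n i)) ℝ, X.PosDef ∧
        LimitedModel.IsRiccatiSolution (LimitedModel.blk A i i) (LimitedModel.blk B i i) X) ∧
    -- `Γ^Θ` is a communication-less control design method
    LimitedModel.gammaTheta GP ∈
      LimitedModel.designMethods n GP GK (LimitedModel.selfLoops q) 𝓑 ∧
    -- every plant has an optimal controller
    (∃ Kstar, LimitedModel.IsOptimalStrategy n GP GK 𝓑 Kstar) ∧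
    -- the competitive ratio
    ∀ Kstar, LimitedModel.IsOptimalStrategy n GP GK 𝓑 Kstar →
      ((LimitedModel.adjacency₁₁ GP = 0 ∧ LimitedModel.adjacency₂₂ GP = 0) →
        LimitedModel.competitiveRatio n GP 𝓑 Kstar (LimitedModel.gammaTheta GP) = 1) ∧
      (¬ (LimitedModel.adjacency₁₁ GP = 0 ∧ LimitedModel.adjacency₂₂ GP = 0) →
        LimitedModel.competitiveRatio n GP 𝓑 Kstar (LimitedModel.gammaTheta GP) =
          ENNReal.ofReal (1 + 1 / ε ^ 2)) := by
  open LimitedModel in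
  subst hGK
  -- Both choices of `𝓑` enter only through these bounds and through the membership of `εI`.
  have hbd : ∀ B ∈ 𝓑, IsBlockDiag B ∧
      ∀ w, ε ^ 2 * (w ⬝ᵥ w) ≤ (B *ᵥ w) ⬝ᵥ (B *ᵥ w) := by
    rcases h𝓑 with rfl | rfl
    · exact fun B hB => ⟨hB.2, sq_mul_dotProduct_le_of_mem_inputMatrices hε.le hB⟩
    · exact fun B hB => ⟨isBlockDiag_of_isDiag hB.1,
        sq_mul_dotProduct_le_of_mem_diagonalInputMatrices hε.le hB⟩
  have hone : ε • (1 : Mat n) ∈ 𝓑 := by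
    rcases h𝓑 with rfl | rfl
    · exact smul_one_mem_inputMatrices hε.le
    · exact smul_one_mem_diagonalInputMatrices ε
  refine ⟨fun A _ B hB i _ => ?_, gammaTheta_mem_designMethods GP 𝓑,
    exists_isOptimalStrategy GP fun B hB => isUnit_of_sq_mul_dotProduct_le hε (hbd B hB).2,
    fun Kstar hK => ⟨fun h => le_antisymm ?_ ?_, fun h => le_antisymm ?_ ?_⟩⟩
  · simp only [isRiccatiSolution_iff]
    exact existsUnique_riccati_fixedPoint _ (isUnit_of_sq_mul_dotProduct_le hε
      ((hbd B hB).1.sq_mul_dotProduct_le (hbd B hB).2 i))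
  · refine competitiveRatio_le le_rfl fun A hA B hB x₀ K => ?_
    obtain ⟨hBd, hBb⟩ := hbd B hB
    have := cost_gammaTheta_le_mul_cost zero_le_one hε hA hBd hBb x₀ K fun i u => by
      rw [one_mul]
      exact blockCost_le_of_adjacency_eq_zero hε hA h.1 h.2 (hBd.sq_mul_dotProduct_le hBb i) x₀ u
    simpa using this
  · exact one_le_competitiveRatio ⟨_, hone⟩ _ hK fun B _ => Matrix.mul_zero _
  · refine competitiveRatio_le ?_ fun A hA B hB x₀ K => ?_
    · rw [ENNReal.one_le_ofReal]
      exact le_add_of_nonneg_right (by positivity)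
    obtain ⟨hBd, hBb⟩ := hbd B hB
    exact cost_gammaTheta_le_mul_cost (by positivity) hε hA hBd hBb x₀ K fun i u =>
      blockCost_le_mul hε (hBd.sq_mul_dotProduct_le hBb i) _ u
  · rw [not_and_or] at h
    rcases h with h | h
    · obtain ⟨i, j, hij⟩ : ∃ i j, adjacency₁₁ GP i j ≠ 0 := by
        by_contra! hc
        exact h (Matrix.ext hc)
      exact le_competitiveRatio_of_adj_not_isSink hε hn hone hK
        (not_not.1 (mt adjacency_eq_zero_iff.2 hij)) i.2
    · obtain ⟨i, j, hij⟩ : ∃ i j, adjacency₂₂ GP i j ≠ 0 := by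
        by_contra! hc
        exact h (Matrix.ext hc)
      have hadj : GP.Adj j.1 i.1 := not_not.1 (mt adjacency_eq_zero_iff.2 hij)
      -- An edge between two sinks can only be a self-loop.
      have hji : i.1 = j.1 := by
        by_contra hne
        exact j.2 i.1 hne hadj
      obtain ⟨l, hl, hli⟩ : ∃ l, l ≠ i.1 ∧ GP.Adj l i.1 := by
        by_contra! hc
        exact hisolated i.1 fun l hl => ⟨i.2 l hl, hc l hl⟩
      exact le_competitiveRatio_of_isSink_adj_self hε hn hone hK (hji ▸ hadj) hli hl
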